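/- Let $d\ge 2$ and let $a:(0,\infty)\to(0,\infty)$ be a $C^2$ function with $a(t)\to 0$ as $t\to 0$. For $K\in\{-1,0,1\}$ let $(\overline M_K,\overline g_K)$ be the simply connected complete $d$-dimensional Riemannian manifold of constant curvature $K$ (hyperbolic space, Euclidean space $\mathbb R^d$, and the round unit sphere $\mathbb S^d$, respectively), and consider the FLRW spacetime $M=(0,\infty)\times\overline M_K$ with Lorentzian metric $g=-dt^2+a(t)^2\,\overline g_K$, time-oriented so that $\partial_t$ is future directed. Then $(M,g)$ is future one-connected. That is, for all $p,q\in M$ and any two future directed timelike curves $\gamma_0,\gamma_1:[0,1]\to M$ from $p$ to $q$, there is a continuous map $\Gamma:[0,1]\times[0,1]\to M$ with $\Gamma(0,\cdot)=\gamma_0$ and $\Gamma(1,\cdot)=\gamma_1$ such that $\Gamma(r,\cdot)$ is a future directed timelike curve from $p$ to $q$ for every $r\in[0,1]$. Here a future directed timelike curve is a continuous, piecewise smooth ($C^\infty$ on each of finitely many closed subintervals) curve whose tangent vectors, including both one-sided tangent vectors at the break points, are all timelike and future directed. -/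

import Mathlib

open Set Filter Topology Manifold
open scoped ContDiff

noncomputable section

namespace FLRW

/-! ### Timelike curves and timelike homotopies -/

section Causality

variable {E : Type*} [NormedAddCommGroup E] [NormedSpace ℝ E]
  {H : Type*} [TopologicalSpace H] (I : ModelWithCorners ℝ E H)
  {M : Type*} [TopologicalSpace M] [ChartedSpace H M]

/-- A tensor field of type `(0,2)`: a bilinear form on every tangent space. -/
abbrev TensorField (I : ModelWithCorners ℝ E H) (M : Type*) [TopologicalSpace M]
    [ChartedSpace H M] : Type _ :=
  ∀ p : M, LinearMap.BilinForm ℝ (TangentSpace I p)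

/-- The tangent vector `v` at `p` is timelike for the Lorentzian metric `g` and future directed
for the time orientation given by the timelike vector field `T` (signature `(-,+,…,+)`). -/
def IsFutureTimelike {I : ModelWithCorners ℝ E H} (g : TensorField I M)
    (T : ∀ p : M, TangentSpace I p) (p : M) (v : TangentSpace I p) : Prop :=
  g p v v < 0 ∧ g p v (T p) < 0

/-- The restriction of `γ` to `[0,1]` is a future directed timelike curve: it is piecewise smooth,
i.e. there is a subdivision `0 = s 0 < s 1 < ⋯ < s n = 1` such that `γ` is smooth on each closed
piece `[s i, s (i + 1)]`, and on each closed piece the tangent vector (one-sided at the two ends)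
is timelike and future directed. Values of `γ` outside `[0,1]` play no role. -/
def IsFutureTimelikeCurve {I : ModelWithCorners ℝ E H} (g : TensorField I M)
    (T : ∀ p : M, TangentSpace I p) (γ : ℝ → M) : Prop :=
  ∃ (n : ℕ) (s : ℕ → ℝ), s 0 = 0 ∧ s n = 1 ∧ ∀ i < n, s i < s (i + 1) ∧
    ContMDiffOn 𝓘(ℝ, ℝ) I ∞ γ (Icc (s i) (s (i + 1))) ∧
    ∀ u ∈ Icc (s i) (s (i + 1)),
      IsFutureTimelike g T (γ u)
        (mfderivWithin 𝓘(ℝ, ℝ) I γ (Icc (s i) (s (i + 1))) u (1 : ℝ))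

/-- `γ` is a future directed timelike curve, defined on `[0,1]`, from `p` to `q`. -/
def IsFutureTimelikeCurveFromTo {I : ModelWithCorners ℝ E H} (g : TensorField I M)
    (T : ∀ p : M, TangentSpace I p) (γ : ℝ → M) (p q : M) : Prop :=
  IsFutureTimelikeCurve g T γ ∧ γ 0 = p ∧ γ 1 = q

/-- The curves `γ₀` and `γ₁` on `[0,1]` are timelike homotopic with fixed endpoints. -/
def TimelikeHomotopic {I : ModelWithCorners ℝ E H} (g : TensorField I M)
    (T : ∀ p : M, TangentSpace I p) (γ₀ γ₁ : ℝ → M) : Prop :=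
  ∃ Γ : ℝ × ℝ → M, ContinuousOn Γ (Icc 0 1 ×ˢ Icc 0 1) ∧
    (∀ r ∈ Icc (0 : ℝ) 1,
      IsFutureTimelikeCurveFromTo g T (fun s => Γ (r, s)) (γ₀ 0) (γ₀ 1)) ∧
    (∀ s ∈ Icc (0 : ℝ) 1, Γ (0, s) = γ₀ s) ∧
    (∀ s ∈ Icc (0 : ℝ) 1, Γ (1, s) = γ₁ s)

/-- Future one-connectedness: any two future directed timelike curves with the same endpoints are
timelike homotopic with fixed endpoints. -/
def FutureOneConnected {I : ModelWithCorners ℝ E H} (g : TensorField I M)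
    (T : ∀ p : M, TangentSpace I p) : Prop :=
  ∀ (p q : M) (γ₀ γ₁ : ℝ → M),
    IsFutureTimelikeCurveFromTo g T γ₀ p q → IsFutureTimelikeCurveFromTo g T γ₁ p q →
      TimelikeHomotopic g T γ₀ γ₁

end Causality

/-! ### The simply connected complete Riemannian geometries of constant curvature -/

/-- Curvature `0`: the Euclidean metric on `ℝ^d`. -/
def euclideanMetric (d : ℕ) : TensorField (𝓡 d) (EuclideanSpace ℝ (Fin d)) :=
  fun _ => (innerₗ (EuclideanSpace ℝ (Fin d)) :
    LinearMap.BilinForm ℝ (EuclideanSpace ℝ (Fin d)))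

/-- Curvature `-1`: hyperbolic space as the upper sheet `x₀ = √(1 + |x|²)` of the hyperboloid
`-x₀² + |x|² = -1` in Minkowski space, in its global coordinates `x ∈ ℝ^d`. The metric induced by
`-dx₀² + |dx|²` is `⟨v, w⟩ - ⟨x, v⟩ ⟨x, w⟩ / (1 + |x|²)`; with `x = sinh r • e` and `|e| = 1`
it reads `dr² + sinh² r g_{S^{d-1}}` (see `hyperbolicMetric_polar`). -/
def hyperbolicMetric (d : ℕ) : TensorField (𝓡 d) (EuclideanSpace ℝ (Fin d)) :=
  fun x => (innerₗ (EuclideanSpace ℝ (Fin d)) - (1 + ‖x‖ ^ 2)⁻¹ •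
      LinearMap.BilinForm.linMulLin (innerₗ (EuclideanSpace ℝ (Fin d)) x)
        (innerₗ (EuclideanSpace ℝ (Fin d)) x) :
    LinearMap.BilinForm ℝ (EuclideanSpace ℝ (Fin d)))

/-- In polar coordinates `x = sinh r • e` the hyperbolic metric is `dr² + sinh² r g_{S^{d-1}}`:
the vector `cosh r dr • e + sinh r • η` with `η ⊥ e` has squared length
`dr² + sinh² r |η|²`. -/
theorem hyperbolicMetric_polar (d : ℕ) (r dr : ℝ) (e η : EuclideanSpace ℝ (Fin d))
    (he : ‖e‖ = 1) (hη : inner ℝ e η = 0) :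
    hyperbolicMetric d (Real.sinh r • e)
        ((Real.cosh r * dr) • e + Real.sinh r • η : EuclideanSpace ℝ (Fin d))
        ((Real.cosh r * dr) • e + Real.sinh r • η : EuclideanSpace ℝ (Fin d)) =
      dr ^ 2 + Real.sinh r ^ 2 * ‖η‖ ^ 2 := by
  have h1 : inner ℝ e e = 1 := by rw [real_inner_self_eq_norm_sq, he]; norm_num
  have h2 : inner ℝ η e = 0 := by rw [real_inner_comm]; exact hη
  have h3 : inner ℝ η η = ‖η‖ ^ 2 := real_inner_self_eq_norm_sq η
  have h4 : ‖Real.sinh r • e‖ ^ 2 = Real.sinh r ^ 2 := by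
    rw [norm_smul, he, mul_one, Real.norm_eq_abs, sq_abs]
  have h5 : 1 + Real.sinh r ^ 2 = Real.cosh r ^ 2 := by rw [Real.cosh_sq]; ring
  have h6 : Real.cosh r ≠ 0 := (Real.cosh_pos r).ne'
  change inner ℝ ((Real.cosh r * dr) • e + Real.sinh r • η)
      ((Real.cosh r * dr) • e + Real.sinh r • η) - (1 + ‖Real.sinh r • e‖ ^ 2)⁻¹ *
      (inner ℝ (Real.sinh r • e) ((Real.cosh r * dr) • e + Real.sinh r • η) *
        inner ℝ (Real.sinh r • e) ((Real.cosh r * dr) • e + Real.sinh r • η)) = _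
  rw [h4, h5]
  simp only [inner_add_left, inner_add_right, real_inner_smul_left, real_inner_smul_right,
    h1, h2, h3, hη]
  field_simp
  linear_combination (-dr ^ 2 * Real.cosh r ^ 2) * h5

/-- Curvature `1`: the round metric on the unit sphere `S^d ⊆ ℝ^(d+1)`, the pullback of the
Euclidean inner product under the differential of the inclusion. -/
def sphereMetric (d : ℕ) :
    TensorField (𝓡 d) (Metric.sphere (0 : EuclideanSpace ℝ (Fin (d + 1))) 1) :=
  fun x =>
    let ι : TangentSpace (𝓡 d) x →ₗ[ℝ] EuclideanSpace ℝ (Fin (d + 1)) :=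
      (mfderiv (𝓡 d) 𝓘(ℝ, EuclideanSpace ℝ (Fin (d + 1)))
        ((↑) : Metric.sphere (0 : EuclideanSpace ℝ (Fin (d + 1))) 1 →
          EuclideanSpace ℝ (Fin (d + 1))) x).toLinearMap
    LinearMap.BilinForm.comp
      (innerₗ (EuclideanSpace ℝ (Fin (d + 1))) :
        LinearMap.BilinForm ℝ (EuclideanSpace ℝ (Fin (d + 1)))) ι ι

/-! ### FLRW spacetimes -/

/-- A scale factor: a `C²` function `(0,∞) → (0,∞)` tending to `0` at `0`. -/
structure IsScaleFactor (a : ℝ → ℝ) : Prop where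
  pos : ∀ t, 0 < t → 0 < a t
  contDiffOn : ContDiffOn ℝ 2 a (Ioi 0)
  tendsto_zero : Tendsto a (𝓝[>] 0) (𝓝 0)

/-- The time axis `(0,∞)`, as an open submanifold of `ℝ`. -/
def TimeAxis : TopologicalSpace.Opens ℝ := ⟨Ioi 0, isOpen_Ioi⟩

section Warped

variable {d : ℕ} {N : Type*} [TopologicalSpace N] [ChartedSpace (EuclideanSpace ℝ (Fin d)) N]

/-- The metric `g = -dt² + a(t)² h` on the product manifold `(0,∞) × N`. The tangent space at
`(t, x)` is the product of `ℝ` and of the tangent space of `N` at `x`. -/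
def warpedMetric (a : ℝ → ℝ) (h : TensorField (𝓡 d) N) :
    TensorField (𝓘(ℝ, ℝ).prod (𝓡 d)) (TimeAxis × N) :=
  fun p =>
    let dt : TangentSpace (𝓘(ℝ, ℝ).prod (𝓡 d)) p →ₗ[ℝ] ℝ :=
      LinearMap.fst ℝ ℝ (TangentSpace (𝓡 d) p.2)
    let pr : TangentSpace (𝓘(ℝ, ℝ).prod (𝓡 d)) p →ₗ[ℝ] TangentSpace (𝓡 d) p.2 :=
      LinearMap.snd ℝ ℝ (TangentSpace (𝓡 d) p.2)
    a (p.1 : ℝ) ^ 2 • LinearMap.BilinForm.comp (h p.2) pr pr -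
      LinearMap.BilinForm.linMulLin dt dt

/-- The vector field `∂_t` on `(0,∞) × N`. -/
def timeField (d : ℕ) (N : Type*) [TopologicalSpace N]
    [ChartedSpace (EuclideanSpace ℝ (Fin d)) N] (p : TimeAxis × N) :
    TangentSpace (𝓘(ℝ, ℝ).prod (𝓡 d)) p :=
  ((1 : ℝ), (0 : TangentSpace (𝓡 d) p.2))

/-- The time oriented Lorentzian manifold `(0,∞) × N` with metric `-dt² + a(t)² h` and with `∂_t`
future directed is future one-connected. -/
def WarpedFutureOneConnected (a : ℝ → ℝ) (h : TensorField (𝓡 d) N) : Prop :=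
  FutureOneConnected (warpedMetric a h) (timeField d N)

end Warped

end FLRW

end

/-! Both curves are deformed to broken segments over a common subdivision of time, and broken
segments with the same ends are then deformed into each other.

The three geometries enter only through `ChordGeometry`. It provides a squared chord `F`, comparable
to squared distance at small scale in both directions (`seg_speed`, `F_le`), with segments joining
nearby points, symmetries fixing `p` that exchange two points at equal chord from `p`, and
preconnected intersections of `F`-balls.

By compactness, a piecewise smooth timelike curve satisfies the timelike inequality with a uniform
factor `θ < 1` (`IsTimelikeOn.exists_uniform`). This gap pays for the errors made by freezing `a` on
short time slabs and by replacing distance with chord. So `exists_grid` finds slabs and slopes `κ i`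
for which two points of the curve in one slab have chord below `κ i` times their time difference,
while any two events with that property are joined by a timelike segment. In each slab the curve can
therefore be coned off to a segment from its first point (`isHomotopic_segment`), which gives a
polygon (`exists_polygon`).

Polygons are treated by induction on the number of slabs (`IsPolygon.isHomotopic`). With the last
vertex `w` fixed, the vertex before it ranges over the points reachable by shorter polygons that lie
in a small ball around `w`. Small moves of that vertex are homotopies, and the induction hypothesis
takes care of the earlier vertices, so it suffices that this set is preconnected. By the symmetries
the reachable set is a ball around `p` (`isPreconnected_reachable`), so the set is an intersection
of two balls. In Euclidean and hyperboloid coordinates such an intersection is convex. On the sphere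
it is an intersection of two caps, connected because the dimension is at least two; on a circle it
may fall into two arcs. -/

open Set Filter Topology Manifold
open scoped ContDiff

noncomputable section

namespace FLRW

/-! ### Concatenation of curves -/

section Concat

variable {M : Type*}

/-- Concatenation of two curves on `[0, 1]`, reparametrized to `[0, 1]`. -/
def concat (γ δ : ℝ → M) (s : ℝ) : M := if s ≤ 1 / 2 then γ (2 * s) else δ (2 * s - 1)

lemma concat_of_le {γ δ : ℝ → M} {s : ℝ} (h : s ≤ 1 / 2) : concat γ δ s = γ (2 * s) := if_pos h

lemma concat_of_ge {γ δ : ℝ → M} {s : ℝ} (e : γ 1 = δ 0) (h : 1 / 2 ≤ s) :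
    concat γ δ s = δ (2 * s - 1) := by
  rcases h.eq_or_lt with rfl | h
  · rw [concat_of_le le_rfl]; norm_num; exact e
  · exact if_neg (not_le.2 h)

@[simp] lemma concat_zero (γ δ : ℝ → M) : concat γ δ 0 = γ 0 := by
  rw [concat_of_le (by norm_num), mul_zero]

@[simp] lemma concat_one (γ δ : ℝ → M) : concat γ δ 1 = δ 1 := by
  unfold concat; norm_num

end Concat

/-! ### Piecewise timelike curves and their homotopies -/

section TimelikeCurves

variable {E : Type*} [NormedAddCommGroup E] [NormedSpace ℝ E]
  {H : Type*} [TopologicalSpace H] {I : ModelWithCorners ℝ E H}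
  {M : Type*} [TopologicalSpace M] [ChartedSpace H M]
  {g : TensorField I M} {T : ∀ p : M, TangentSpace I p}

/-- `γ` is smooth, timelike and future directed on `[a, b]`. -/
def IsPiece (g : TensorField I M) (T : ∀ p : M, TangentSpace I p) (γ : ℝ → M) (a b : ℝ) : Prop :=
  a < b ∧ ContMDiffOn 𝓘(ℝ, ℝ) I ∞ γ (Icc a b) ∧
    ∀ u ∈ Icc a b, IsFutureTimelike g T (γ u) (mfderivWithin 𝓘(ℝ, ℝ) I γ (Icc a b) u (1 : ℝ))

/-- `γ` is piecewise smooth, timelike and future directed on `[a, b]`. -/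
def IsTimelikeOn (g : TensorField I M) (T : ∀ p : M, TangentSpace I p) (γ : ℝ → M)
    (a b : ℝ) : Prop :=
  Relation.TransGen (IsPiece g T γ) a b

lemma uniqueMDiffWithinAt_Icc {a b u : ℝ} (h : a < b) (hu : u ∈ Icc a b) :
    UniqueMDiffWithinAt 𝓘(ℝ, ℝ) (Icc a b) u :=
  uniqueMDiffWithinAt_iff_uniqueDiffWithinAt.2 (uniqueDiffOn_Icc h u hu)

/-- A subdivision is a chain of pieces. As a transitive closure, it makes gluing a use of
transitivity and restriction an induction on the chain. -/
lemma isFutureTimelikeCurve_iff {γ : ℝ → M} :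
    IsFutureTimelikeCurve g T γ ↔ IsTimelikeOn g T γ 0 1 := by
  constructor
  · rintro ⟨n, s, h0, h1, h⟩
    have key : ∀ k, k + 1 ≤ n → IsTimelikeOn g T γ (s 0) (s (k + 1)) := by
      intro k
      induction k with
      | zero => intro hk; exact .single (h 0 hk)
      | succ k ih => intro hk; exact (ih (by omega)).tail (h (k + 1) (by omega))
    rcases n with _ | n
    · exact absurd (h0.symm.trans h1) (by norm_num)
    · rw [← h0, ← h1]; exact key n le_rfl
  · intro h
    have key : ∀ b, IsTimelikeOn g T γ 0 b → ∃ (n : ℕ) (s : ℕ → ℝ), s 0 = 0 ∧ s n = b ∧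
        ∀ i < n, IsPiece g T γ (s i) (s (i + 1)) := by
      intro b hb
      induction hb with
      | @single b hb =>
        refine ⟨1, fun i => if i = 0 then 0 else b, by simp, by simp, ?_⟩
        intro i hi
        obtain rfl : i = 0 := by omega
        simpa using hb
      | @tail b c _ hbc ih =>
        obtain ⟨n, s, h0, hn, hs⟩ := ih
        refine ⟨n + 1, fun i => if i ≤ n then s i else c, by simp [h0], by simp, ?_⟩
        intro i hi
        rcases Nat.lt_succ_iff_lt_or_eq.1 hi with hi' | rfl
        · simpa [hi'.le, Nat.succ_le_iff.2 hi'] using hs i hi'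
        · simpa [hn] using hbc
    exact key 1 h

lemma IsPiece.congr {γ γ' : ℝ → M} {a b : ℝ} (h : IsPiece g T γ a b)
    (hγ : ∀ u ∈ Icc a b, γ' u = γ u) : IsPiece g T γ' a b := by
  refine ⟨h.1, h.2.1.congr hγ, fun u hu => ?_⟩
  have := h.2.2 u hu
  rw [← mfderivWithin_congr hγ (hγ u hu)] at this
  have e := hγ u hu
  unfold IsFutureTimelike at *
  rw [e]
  exact this

lemma IsPiece.mono {γ : ℝ → M} {a b a' b' : ℝ} (h : IsPiece g T γ a b)
    (ha : a ≤ a') (hab : a' < b') (hb : b' ≤ b) : IsPiece g T γ a' b' := by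
  have hs : Icc a' b' ⊆ Icc a b := Icc_subset_Icc ha hb
  refine ⟨hab, h.2.1.mono hs, fun u hu => ?_⟩
  rw [MDifferentiableWithinAt.mfderivWithin_mono
    ((h.2.1 u (hs hu)).mdifferentiableWithinAt (by simp)) (uniqueMDiffWithinAt_Icc hab hu) hs]
  exact h.2.2 u (hs hu)

/-- The tangent vector is multiplied by `k > 0`, and the future timelike vectors form a cone. -/
lemma IsPiece.comp_affine {γ : ℝ → M} {k c a b : ℝ} (hk : 0 < k)
    (h : IsPiece g T γ (k * a + c) (k * b + c)) : IsPiece g T (fun u => γ (k * u + c)) a b := by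
  have hab : a < b := by
    have := h.1
    exact lt_of_mul_lt_mul_left (by linarith) hk.le
  have hmaps : MapsTo (fun u => k * u + c) (Icc a b) (Icc (k * a + c) (k * b + c)) := fun u hu =>
    ⟨by have := mul_le_mul_of_nonneg_left hu.1 hk.le; linarith,
      by have := mul_le_mul_of_nonneg_left hu.2 hk.le; linarith⟩
  have hφ : ContDiff ℝ ∞ (fun u : ℝ => k * u + c) := by fun_prop
  refine ⟨hab, h.2.1.comp hφ.contMDiff.contMDiffOn hmaps, fun u hu => ?_⟩
  have hd : HasDerivWithinAt (fun u : ℝ => k * u + c) k (Icc a b) u := by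
    simpa using (((hasDerivAt_id u).const_mul k).add_const c).hasDerivWithinAt
  have e : mfderivWithin 𝓘(ℝ, ℝ) 𝓘(ℝ, ℝ) (fun u : ℝ => k * u + c) (Icc a b) u (1 : ℝ) = k := by
    rw [mfderivWithin_eq_fderivWithin]
    change derivWithin (fun u : ℝ => k * u + c) (Icc a b) u = k
    exact hd.derivWithin (uniqueDiffOn_Icc hab u hu)
  have hcomp := mfderivWithin_comp (I := 𝓘(ℝ, ℝ)) (I' := 𝓘(ℝ, ℝ)) (I'' := I) u
    ((h.2.1 _ (hmaps hu)).mdifferentiableWithinAt (by simp))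
    (hφ.contMDiff.contMDiffOn.mdifferentiableOn (by simp) u hu) hmaps.subset_preimage
    (uniqueMDiffWithinAt_Icc hab hu)
  have e2 : mfderivWithin 𝓘(ℝ, ℝ) I (fun u => γ (k * u + c)) (Icc a b) u (1 : ℝ) =
      k • mfderivWithin 𝓘(ℝ, ℝ) I γ (Icc (k * a + c) (k * b + c)) (k * u + c) (1 : ℝ) := by
    change mfderivWithin 𝓘(ℝ, ℝ) I (γ ∘ fun u => k * u + c) (Icc a b) u (1 : ℝ) = _
    rw [hcomp]
    change mfderivWithin 𝓘(ℝ, ℝ) I γ (Icc (k * a + c) (k * b + c)) (k * u + c)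
      (mfderivWithin 𝓘(ℝ, ℝ) 𝓘(ℝ, ℝ) (fun u : ℝ => k * u + c) (Icc a b) u (1 : ℝ)) = _
    rw [e]
    refine Eq.trans ?_ (map_smul _ k (1 : ℝ))
    exact congrArg _ (mul_one k).symm
  have ht := h.2.2 _ (hmaps hu)
  rw [e2]
  unfold IsFutureTimelike at *
  simp only [map_smul, LinearMap.smul_apply, smul_eq_mul]
  exact ⟨mul_neg_of_pos_of_neg hk (mul_neg_of_pos_of_neg hk ht.1), mul_neg_of_pos_of_neg hk ht.2⟩

lemma IsTimelikeOn.lt {γ : ℝ → M} {a b : ℝ} (h : IsTimelikeOn g T γ a b) : a < b := by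
  induction h with
  | single h => exact h.1
  | tail _ h ih => exact ih.trans h.1

lemma IsTimelikeOn.continuousOn {γ : ℝ → M} {a b : ℝ} (h : IsTimelikeOn g T γ a b) :
    ContinuousOn γ (Icc a b) := by
  induction h with
  | single h => exact h.2.1.continuousOn
  | @tail b c h h' ih =>
    rw [← Icc_union_Icc_eq_Icc (IsTimelikeOn.lt h).le h'.1.le]
    exact ih.union_of_isClosed h'.2.1.continuousOn isClosed_Icc isClosed_Icc

lemma IsTimelikeOn.congr {γ γ' : ℝ → M} {a b : ℝ} (h : IsTimelikeOn g T γ a b)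
    (hγ : ∀ u ∈ Icc a b, γ' u = γ u) : IsTimelikeOn g T γ' a b := by
  induction h with
  | single h => exact .single (h.congr hγ)
  | @tail b c h h' ih =>
    have := IsTimelikeOn.lt h
    have h1 := h'.1
    exact (ih fun u hu => hγ u ⟨hu.1, hu.2.trans h1.le⟩).tail
      (h'.congr fun u hu => hγ u ⟨this.le.trans hu.1, hu.2⟩)

lemma IsTimelikeOn.left {γ : ℝ → M} {a b c : ℝ} (h : IsTimelikeOn g T γ a b) (hc : a < c)
    (hcb : c ≤ b) : IsTimelikeOn g T γ a c := by
  induction h with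
  | single h => exact .single (h.mono le_rfl hc hcb)
  | @tail b b' h h' ih =>
    rcases le_or_gt c b with hb | hb
    · exact ih hb
    · exact h.tail (h'.mono le_rfl hb hcb)

lemma IsTimelikeOn.right {γ : ℝ → M} {a b c : ℝ} (h : IsTimelikeOn g T γ a b) (hc : a ≤ c)
    (hcb : c < b) : IsTimelikeOn g T γ c b := by
  induction h with
  | single h => exact .single (h.mono hc hcb le_rfl)
  | @tail b b' h h' ih =>
    rcases lt_or_ge c b with hb | hb
    · exact (ih hb).tail h'
    · exact .single (h'.mono hb hcb le_rfl)

lemma IsTimelikeOn.comp_affine {γ : ℝ → M} {k c a b a' b' : ℝ} (hk : 0 < k)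
    (h : IsTimelikeOn g T γ a' b') (ha : a' = k * a + c) (hb : b' = k * b + c) :
    IsTimelikeOn g T (fun u => γ (k * u + c)) a b := by
  induction h generalizing b with
  | single h => subst ha hb; exact .single (h.comp_affine hk)
  | @tail d e h h' ih =>
    -- The break point `d`, pulled back by the affine map.
    have hd : d = k * ((d - c) / k) + c := by field_simp; ring
    refine (ih hd).tail ?_
    refine IsPiece.comp_affine hk ?_
    rw [← hd, ← hb]
    exact h'

/-- A continuous family of timelike curves on `[0, 1]`. -/
def IsTimelikeFamily (g : TensorField I M) (T : ∀ p : M, TangentSpace I p) (Γ : ℝ × ℝ → M) : Prop :=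
  ContinuousOn Γ (Icc 0 1 ×ˢ Icc 0 1) ∧
    ∀ r ∈ Icc (0 : ℝ) 1, IsTimelikeOn g T (fun s => Γ (r, s)) 0 1

/-- Timelike homotopy relative to the endpoints, stated for the restrictions to `[0, 1]`. -/
def IsHomotopic (g : TensorField I M) (T : ∀ p : M, TangentSpace I p) (γ γ' : ℝ → M) : Prop :=
  ∃ Γ, IsTimelikeFamily g T Γ ∧ (∀ r ∈ Icc (0 : ℝ) 1, Γ (r, 0) = γ 0 ∧ Γ (r, 1) = γ 1) ∧
    (∀ s ∈ Icc (0 : ℝ) 1, Γ (0, s) = γ s) ∧ (∀ s ∈ Icc (0 : ℝ) 1, Γ (1, s) = γ' s)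

lemma IsHomotopic.zero_eq {γ γ' : ℝ → M} (h : IsHomotopic g T γ γ') : γ' 0 = γ 0 := by
  obtain ⟨Γ, -, he, -, h1⟩ := h
  rw [← h1 0 (by simp), (he 1 (by simp)).1]

lemma IsHomotopic.one_eq {γ γ' : ℝ → M} (h : IsHomotopic g T γ γ') : γ' 1 = γ 1 := by
  obtain ⟨Γ, -, he, -, h1⟩ := h
  rw [← h1 1 (by simp), (he 1 (by simp)).2]

lemma IsHomotopic.of_eqOn {γ γ' : ℝ → M} (h : IsTimelikeOn g T γ 0 1)
    (hγ : ∀ u ∈ Icc (0 : ℝ) 1, γ' u = γ u) : IsHomotopic g T γ γ' := by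
  refine ⟨fun z => γ z.2, ⟨h.continuousOn.comp continuousOn_snd fun z hz => hz.2, fun _ _ => h⟩,
    fun _ _ => ⟨rfl, rfl⟩, fun _ _ => rfl, fun s hs => (hγ s hs).symm⟩

lemma IsHomotopic.refl {γ : ℝ → M} (h : IsTimelikeOn g T γ 0 1) : IsHomotopic g T γ γ :=
  .of_eqOn h fun _ _ => rfl

lemma IsHomotopic.symm {γ γ' : ℝ → M} (h : IsHomotopic g T γ γ') : IsHomotopic g T γ' γ := by
  have e0 := h.zero_eq
  have e1 := h.one_eq
  obtain ⟨Γ, hΓ, he, h0, h1⟩ := h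
  have hI : ∀ r ∈ Icc (0 : ℝ) 1, 1 - r ∈ Icc (0 : ℝ) 1 := fun r hr =>
    ⟨by linarith [hr.2], by linarith [hr.1]⟩
  refine ⟨fun z => Γ (1 - z.1, z.2), ⟨hΓ.1.comp (by fun_prop) fun z hz => ⟨hI _ hz.1, hz.2⟩,
    fun r hr => hΓ.2 _ (hI r hr)⟩, fun r hr => ?_, fun s hs => ?_, fun s hs => ?_⟩
  · rw [e0, e1]; exact he _ (hI r hr)
  · simpa using h1 s hs
  · simpa using h0 s hs

lemma IsHomotopic.trans {γ γ' γ'' : ℝ → M} (h : IsHomotopic g T γ γ')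
    (h' : IsHomotopic g T γ' γ'') : IsHomotopic g T γ γ'' := by
  have e0 := h.zero_eq
  have e1 := h.one_eq
  obtain ⟨Γ, hΓ, he, h0, h1⟩ := h
  obtain ⟨Δ, hΔ, ke, k0, k1⟩ := h'
  have hI : ∀ r ∈ Icc (0 : ℝ) 1, r ≤ 1 / 2 → 2 * r ∈ Icc (0 : ℝ) 1 := fun r hr h =>
    ⟨by linarith [hr.1], by linarith⟩
  have hJ : ∀ r ∈ Icc (0 : ℝ) 1, 1 / 2 ≤ r → 2 * r - 1 ∈ Icc (0 : ℝ) 1 := fun r hr h =>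
    ⟨by linarith, by linarith [hr.2]⟩
  set Θ : ℝ × ℝ → M := fun z => if z.1 ≤ 1 / 2 then Γ (2 * z.1, z.2) else Δ (2 * z.1 - 1, z.2)
    with hΘ
  have hlow : ∀ r s : ℝ, r ≤ 1 / 2 → Θ (r, s) = Γ (2 * r, s) := fun r s h => if_pos h
  have hhigh : ∀ r s : ℝ, s ∈ Icc (0 : ℝ) 1 → 1 / 2 ≤ r → Θ (r, s) = Δ (2 * r - 1, s) := by
    intro r s hs h
    rcases h.eq_or_lt with rfl | h
    · rw [hlow _ _ le_rfl]; norm_num; rw [h1 s hs, k0 s hs]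
    · exact if_neg (not_le.2 h)
  refine ⟨Θ, ⟨?_, fun r hr => ?_⟩, fun r hr => ?_, fun s hs => ?_, fun s hs => ?_⟩
  · have hu : Icc (0 : ℝ) 1 ×ˢ Icc (0 : ℝ) 1 ⊆
        (Icc 0 (1 / 2) ×ˢ Icc (0 : ℝ) 1) ∪ (Icc (1 / 2) 1 ×ˢ Icc (0 : ℝ) 1) := by
      rintro ⟨r, s⟩ ⟨hr, hs⟩
      rcases le_total r (1 / 2) with h | h
      · exact Or.inl ⟨⟨hr.1, h⟩, hs⟩
      · exact Or.inr ⟨⟨h, hr.2⟩, hs⟩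
    refine ContinuousOn.mono ?_ hu
    refine ContinuousOn.union_of_isClosed ?_ ?_ (isClosed_Icc.prod isClosed_Icc)
      (isClosed_Icc.prod isClosed_Icc)
    · have : ContinuousOn (fun z : ℝ × ℝ => Γ (2 * z.1, z.2)) (Icc 0 (1 / 2) ×ˢ Icc (0 : ℝ) 1) :=
        hΓ.1.comp (by fun_prop) fun z hz =>
          ⟨hI _ ⟨hz.1.1, by linarith [hz.1.2]⟩ hz.1.2, hz.2⟩
      exact this.congr fun z hz => hlow _ _ hz.1.2
    · have : ContinuousOn (fun z : ℝ × ℝ => Δ (2 * z.1 - 1, z.2))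
          (Icc (1 / 2) 1 ×ˢ Icc (0 : ℝ) 1) :=
        hΔ.1.comp (by fun_prop) fun z hz =>
          ⟨hJ _ ⟨by linarith [hz.1.1], hz.1.2⟩ hz.1.1, hz.2⟩
      exact this.congr fun z hz => hhigh _ _ hz.2 hz.1.1
  · rcases le_total r (1 / 2) with h | h
    · exact (hΓ.2 _ (hI r hr h)).congr fun s _ => hlow r s h
    · exact (hΔ.2 _ (hJ r hr h)).congr fun s hs => hhigh r s hs h
  · rcases le_total r (1 / 2) with h | h
    · rw [hlow _ _ h, hlow _ _ h]; exact he _ (hI r hr h)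
    · rw [hhigh _ _ (by simp) h, hhigh _ _ (by simp) h, ← e0, ← e1]; exact ke _ (hJ r hr h)
  · rw [hlow _ _ (by norm_num), mul_zero]; exact h0 s hs
  · rw [hhigh _ _ hs (by norm_num)]; norm_num; exact k1 s hs

lemma IsTimelikeOn.concat {γ δ : ℝ → M} (h : IsTimelikeOn g T γ 0 1) (h' : IsTimelikeOn g T δ 0 1)
    (e : γ 1 = δ 0) : IsTimelikeOn g T (concat γ δ) 0 1 := by
  have h1 : IsTimelikeOn g T (FLRW.concat γ δ) 0 (1 / 2) :=
    (h.comp_affine (k := 2) (c := 0) (a := 0) (b := 1 / 2) (by norm_num) (by norm_num)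
      (by norm_num)).congr fun u hu => by rw [concat_of_le hu.2, add_zero]
  have h2 : IsTimelikeOn g T (FLRW.concat γ δ) (1 / 2) 1 :=
    (h'.comp_affine (k := 2) (c := -1) (a := 1 / 2) (b := 1) (by norm_num) (by norm_num)
      (by norm_num)).congr fun u hu => by rw [concat_of_ge e hu.1, sub_eq_add_neg]
  exact Relation.TransGen.trans h1 h2

lemma IsTimelikeFamily.concat {Γ Δ : ℝ × ℝ → M} (h : IsTimelikeFamily g T Γ)
    (h' : IsTimelikeFamily g T Δ) (e : ∀ r ∈ Icc (0 : ℝ) 1, Γ (r, 1) = Δ (r, 0)) :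
    IsTimelikeFamily g T
      (fun z => concat (fun s => Γ (z.1, s)) (fun s => Δ (z.1, s)) z.2) := by
  refine ⟨?_, fun r hr => (h.2 r hr).concat (h'.2 r hr) (e r hr)⟩
  have hu : Icc (0 : ℝ) 1 ×ˢ Icc (0 : ℝ) 1 ⊆
      (Icc (0 : ℝ) 1 ×ˢ Icc (0 : ℝ) (1 / 2)) ∪ (Icc (0 : ℝ) 1 ×ˢ Icc (1 / 2) 1) := by
    rintro ⟨r, s⟩ ⟨hr, hs⟩
    rcases le_total s (1 / 2) with h | h
    · exact Or.inl ⟨hr, hs.1, h⟩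
    · exact Or.inr ⟨hr, h, hs.2⟩
  refine ContinuousOn.mono ?_ hu
  refine ContinuousOn.union_of_isClosed ?_ ?_ (isClosed_Icc.prod isClosed_Icc)
    (isClosed_Icc.prod isClosed_Icc)
  · have : ContinuousOn (fun z : ℝ × ℝ => Γ (z.1, 2 * z.2)) (Icc (0 : ℝ) 1 ×ˢ Icc 0 (1 / 2)) :=
      h.1.comp (by fun_prop) fun z hz =>
        ⟨hz.1, by linarith [hz.2.1], by linarith [hz.2.2]⟩
    exact this.congr fun z hz => concat_of_le hz.2.2
  · have : ContinuousOn (fun z : ℝ × ℝ => Δ (z.1, 2 * z.2 - 1)) (Icc (0 : ℝ) 1 ×ˢ Icc (1 / 2) 1) :=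
      h'.1.comp (by fun_prop) fun z hz =>
        ⟨hz.1, by linarith [hz.2.1], by linarith [hz.2.2]⟩
    exact this.congr fun z hz => concat_of_ge (e _ hz.1) hz.2.1

lemma IsHomotopic.concat {γ γ' δ δ' : ℝ → M} (h : IsHomotopic g T γ γ')
    (h' : IsHomotopic g T δ δ') (e : γ 1 = δ 0) :
    IsHomotopic g T (concat γ δ) (concat γ' δ') := by
  have e' : γ' 1 = δ' 0 := by rw [h.one_eq, h'.zero_eq, e]
  obtain ⟨Γ, hΓ, he, h0, h1⟩ := h
  obtain ⟨Δ, hΔ, ke, k0, k1⟩ := h'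
  refine ⟨_, hΓ.concat hΔ fun r hr => by rw [(he r hr).2, (ke r hr).1, e], fun r hr => ?_,
    fun s hs => ?_, fun s hs => ?_⟩
  · simp [(he r hr).1, (ke r hr).2]
  all_goals
    rcases le_total s (1 / 2) with h | h
    · have : 2 * s ∈ Icc (0 : ℝ) 1 := ⟨by linarith [hs.1], by linarith⟩
      simp only [concat_of_le h, h0 _ this, h1 _ this]
    · have : 2 * s - 1 ∈ Icc (0 : ℝ) 1 := ⟨by linarith, by linarith [hs.2]⟩
      rw [concat_of_ge (by
        first
          | exact ((he 0 (by simp)).2.trans e).trans (ke 0 (by simp)).1.symm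
          | exact ((he 1 (by simp)).2.trans e).trans (ke 1 (by simp)).1.symm) h,
        concat_of_ge (by first | exact e | exact e') h]
      first | exact k0 _ this | exact k1 _ this

/-- A timelike curve is homotopic to the concatenation of its two restrictions at a time `m`. -/
lemma IsTimelikeOn.isHomotopic_cut {γ : ℝ → M} (h : IsTimelikeOn g T γ 0 1) {m : ℝ}
    (hm : m ∈ Ioo (0 : ℝ) 1) :
    IsHomotopic g T γ (FLRW.concat (fun s => γ (m * s)) (fun s => γ ((1 - m) * s + m))) := by
  -- The cut moves from `1 / 2`, where cutting and concatenating gives back `γ` itself, to `m`.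
  set μ : ℝ → ℝ := fun r => (1 - r) * (1 / 2) + r * m with hμ
  have hμI : ∀ r ∈ Icc (0 : ℝ) 1, μ r ∈ Ioo (0 : ℝ) 1 := by
    rintro r ⟨h0, h1⟩
    obtain ⟨m0, m1⟩ := hm
    constructor <;> simp only [hμ] <;> nlinarith
  have h1 : IsTimelikeFamily g T (fun z => γ (μ z.1 * z.2)) := by
    refine ⟨h.continuousOn.comp (by fun_prop) ?_, fun r hr => ?_⟩
    · rintro ⟨r, s⟩ ⟨hr, hs⟩
      have := hμI r hr
      exact ⟨mul_nonneg this.1.le hs.1, mul_le_one₀ this.2.le hs.1 hs.2⟩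
    · have := hμI r hr
      simpa using (h.left this.1 this.2.le).comp_affine (k := μ r) (c := 0) (a := 0) (b := 1)
        this.1 (by simp) (by simp)
  have h2 : IsTimelikeFamily g T (fun z => γ ((1 - μ z.1) * z.2 + μ z.1)) := by
    refine ⟨h.continuousOn.comp (by fun_prop) ?_, fun r hr => ?_⟩
    · rintro ⟨r, s⟩ ⟨hr, hs⟩
      have := hμI r hr
      have h3 := mul_nonneg (sub_nonneg.2 this.2.le) hs.1
      have h4 := mul_nonneg (sub_nonneg.2 this.2.le) (sub_nonneg.2 hs.2)
      exact ⟨by linarith [this.1], by simp only at *; linarith⟩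
    · have := hμI r hr
      exact (h.right this.1.le this.2).comp_affine (k := 1 - μ r) (c := μ r) (a := 0) (b := 1)
        (by linarith [this.2]) (by simp) (by simp)
  have e : ∀ r, (fun z : ℝ × ℝ => γ (μ z.1 * z.2)) (r, 1) =
      (fun z : ℝ × ℝ => γ ((1 - μ z.1) * z.2 + μ z.1)) (r, 0) := by intro r; simp
  refine ⟨_, h1.concat h2 fun r _ => e r, fun r _ => by simp, fun s hs => ?_, fun s hs => ?_⟩
  · rcases le_total s (1 / 2) with h | h
    · simp only [concat_of_le h, hμ]; congr 1; ring
    · rw [concat_of_ge (e 0) h]; simp only [hμ]; congr 1; ring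
  · simp [hμ]

end TimelikeCurves

/-! ### The time axis as a manifold -/

section TimeAxis

/-- The chart of an open subset is a restriction of the ambient identity chart, so the inclusion
reads as the identity near the point. -/
lemma hasMFDerivAt_timeAxis_val (p : TimeAxis) :
    HasMFDerivAt 𝓘(ℝ, ℝ) 𝓘(ℝ, ℝ) (Subtype.val : TimeAxis → ℝ) p (ContinuousLinearMap.id ℝ ℝ) := by
  refine ⟨continuous_subtype_val.continuousAt, ?_⟩
  have h := TopologicalSpace.Opens.chartAt_subtype_val_symm_eventuallyEq (H := ℝ) TimeAxis (x := p)
  have h' : ∀ᶠ y in 𝓝 (extChartAt 𝓘(ℝ, ℝ) p p),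
      writtenInExtChartAt 𝓘(ℝ, ℝ) 𝓘(ℝ, ℝ) p (Subtype.val : TimeAxis → ℝ) y = id y := by
    filter_upwards [h] with y hy
    exact hy.symm
  exact (hasFDerivWithinAt_id (𝕜 := ℝ) _ _).congr_of_eventuallyEq
    (h'.filter_mono nhdsWithin_le_nhds) h'.self_of_nhds

/-- The point of the time axis with coordinate `t > 0`. -/
def toTime (t : ℝ) : TimeAxis := if h : 0 < t then ⟨t, h⟩ else ⟨1, mem_Ioi.2 one_pos⟩

lemma coe_toTime {t : ℝ} (h : 0 < t) : (toTime t : ℝ) = t := by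
  unfold toTime; rw [dif_pos h]

lemma toTime_coe (p : TimeAxis) : toTime (p : ℝ) = p := Subtype.ext (coe_toTime p.2)

lemma contMDiffOn_toTime : ContMDiffOn 𝓘(ℝ, ℝ) 𝓘(ℝ, ℝ) ∞ toTime (Ioi 0) := by
  intro t ht
  rw [← ContMDiffWithinAt.subtypeVal_comp_iff]
  exact contMDiffWithinAt_id.congr (fun u hu => coe_toTime hu) (coe_toTime ht)

lemma continuousOn_toTime : ContinuousOn toTime (Ioi 0) := contMDiffOn_toTime.continuousOn

end TimeAxis

/-- A Riemannian metric `h` on `N` described in an ambient vector space `V` by a quadratic form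
`Q`, together with a "squared chord length" `F` comparable to the squared distance at small scale,
connecting segments, symmetries and connectivity of the intersections of small `F`-balls with
`F`-balls of any radius. -/
structure ChordGeometry {d : ℕ} {N : Type*} [TopologicalSpace N]
    [ChartedSpace (EuclideanSpace ℝ (Fin d)) N] (h : TensorField (𝓡 d) N)
    (V : Type*) [NormedAddCommGroup V] [NormedSpace ℝ V] where
  ι : N → V
  Q : V → V → ℝ
  F : N → N → ℝ
  seg : N → N → ℝ → N
  ε₀ : ℝ
  contMDiff_ι : ContMDiff (𝓡 d) 𝓘(ℝ, V) ∞ ι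
  metric_eq : ∀ (p : N) (v : TangentSpace (𝓡 d) p), h p v v = Q (ι p) (mfderiv (𝓡 d) 𝓘(ℝ, V) ι p v)
  continuous_Q : Continuous fun z : V × V => Q z.1 z.2
  continuous_F : Continuous fun z : N × N => F z.1 z.2
  F_self : ∀ x, F x x = 0
  F_comm : ∀ x y, F x y = F y x
  ε₀_pos : 0 < ε₀
  seg_zero : ∀ u v, F u v < ε₀ → seg u v 0 = u
  seg_one : ∀ u v, F u v < ε₀ → seg u v 1 = v
  seg_self : ∀ u, ∀ s ∈ Icc (0 : ℝ) 1, seg u u s = u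
  continuousOn_seg : ContinuousOn (fun z : (N × N) × ℝ => seg z.1.1 z.1.2 z.2)
    {z | F z.1.1 z.1.2 < ε₀ ∧ z.2 ∈ Icc (0 : ℝ) 1}
  contMDiffOn_seg : ∀ u v, F u v < ε₀ → ContMDiffOn 𝓘(ℝ, ℝ) (𝓡 d) ∞ (seg u v) (Icc 0 1)
  -- Short segments are nearly as efficient as geodesics: their squared speed exceeds the squared
  -- chord by at most the factor `c`.
  seg_speed : ∀ c : ℝ, 1 < c → ∃ ε > 0, ∀ u v, F u v < ε → F u v < ε₀ → ∀ s ∈ Icc (0 : ℝ) 1,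
    Q (ι (seg u v s)) (derivWithin (fun s => ι (seg u v s)) (Icc 0 1) s) ≤ c * F u v
  -- Conversely, a short curve bounds the chord between its ends. Right derivatives are used because
  -- they also exist at the break points.
  F_le : ∀ c : ℝ, 1 < c → ∃ ε > 0, ∀ (κ : ℝ) (x : ℝ → N) (t : ℝ → ℝ) (α β : ℝ), 0 < κ → α ≤ β →
    ContinuousOn x (Icc α β) → ContinuousOn t (Icc α β) →
    (∀ u ∈ Ico α β, ∃ (X' : V) (t' : ℝ), HasDerivWithinAt (fun s => ι (x s)) X' (Ici u) u ∧
      HasDerivWithinAt t t' (Ici u) u ∧ 0 < t' ∧ Q (ι (x u)) X' < κ ^ 2 * t' ^ 2) →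
    κ * (t β - t α) < ε → F (x α) (x β) ≤ c * (κ * (t β - t α)) ^ 2
  homogeneous : ∀ p x y, F p x = F p y →
    ∃ σ : N → N, σ p = p ∧ σ x = y ∧ ∀ z w, F (σ z) (σ w) = F z w
  -- An interval `J` containing `0` covers open balls, closed balls and the whole space at once, so
  -- the shape of the reachable set need not be computed.
  isPreconnected_inter : ∀ (p q : N) (J : Set ℝ) (c : ℝ), J.OrdConnected → 0 ∈ J → c ≤ ε₀ →
    IsPreconnected {x | F p x ∈ J ∧ F q x < c}

lemma _root_.ContDiffOn.hasDerivWithinAt_Ici {W : Type*} [NormedAddCommGroup W] [NormedSpace ℝ W]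
    {f : ℝ → W} {α β u : ℝ} (hf : ContDiffOn ℝ ∞ f (Icc α β)) (hu : u ∈ Ico α β) :
    HasDerivWithinAt f (derivWithin f (Icc α β) u) (Ici u) u := by
  have := (hf.differentiableOn (by simp) u (Ico_subset_Icc_self hu)).hasDerivWithinAt
  exact (this.mono (Icc_subset_Icc_left hu.1)).mono_of_mem_nhdsWithin (Icc_mem_nhdsGE hu.2)

/-! ### Timelike curves and segments in a warped product -/

section Warped

variable {d : ℕ} {N : Type*} [TopologicalSpace N] [ChartedSpace (EuclideanSpace ℝ (Fin d)) N]
  {a : ℝ → ℝ} {h : TensorField (𝓡 d) N}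
  {V : Type*} [NormedAddCommGroup V] [NormedSpace ℝ V]

lemma isFutureTimelike_warped_iff (p : TimeAxis × N)
    (v : TangentSpace (𝓘(ℝ, ℝ).prod (𝓡 d)) p) :
    IsFutureTimelike (warpedMetric a h) (timeField d N) p v ↔
      0 < (v.1 : ℝ) ∧ a p.1 ^ 2 * h p.2 v.2 v.2 < (v.1 : ℝ) ^ 2 := by
  have e1 : warpedMetric a h p v v = a p.1 ^ 2 * h p.2 v.2 v.2 - (v.1 : ℝ) * v.1 := rfl
  have e2 : warpedMetric a h p v (timeField d N p) =
      a p.1 ^ 2 * h p.2 v.2 (0 : TangentSpace (𝓡 d) p.2) - (v.1 : ℝ) * 1 := rfl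
  unfold IsFutureTimelike
  rw [e1, e2, map_zero]
  constructor
  · rintro ⟨h1, h2⟩; exact ⟨by linarith, by linarith [sq (v.1 : ℝ)]⟩
  · rintro ⟨h1, h2⟩; exact ⟨by linarith [sq (v.1 : ℝ)], by linarith⟩

/-- The time coordinate along a curve. -/
def timeOf (γ : ℝ → TimeAxis × N) (u : ℝ) : ℝ := (γ u).1

/-- The position along a curve, in the ambient vector space. -/
def ChordGeometry.pos (G : ChordGeometry h V) (γ : ℝ → TimeAxis × N) (u : ℝ) : V := G.ι (γ u).2

lemma contDiffOn_timeOf {γ : ℝ → TimeAxis × N} {s : Set ℝ}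
    (hγ : ContMDiffOn 𝓘(ℝ, ℝ) (𝓘(ℝ, ℝ).prod (𝓡 d)) ∞ γ s) : ContDiffOn ℝ ∞ (timeOf γ) s := by
  rw [← contMDiffOn_iff_contDiffOn]
  exact (contMDiff_subtype_val.comp contMDiff_fst).comp_contMDiffOn hγ

lemma ChordGeometry.contDiffOn_pos (G : ChordGeometry h V) {γ : ℝ → TimeAxis × N} {s : Set ℝ}
    (hγ : ContMDiffOn 𝓘(ℝ, ℝ) (𝓘(ℝ, ℝ).prod (𝓡 d)) ∞ γ s) : ContDiffOn ℝ ∞ (G.pos γ) s := by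
  rw [← contMDiffOn_iff_contDiffOn]
  exact (G.contMDiff_ι.comp contMDiff_snd).comp_contMDiffOn hγ

lemma mfderivWithin_fst_eq {γ : ℝ → TimeAxis × N} {s : Set ℝ} {u : ℝ}
    (hγ : MDifferentiableWithinAt 𝓘(ℝ, ℝ) (𝓘(ℝ, ℝ).prod (𝓡 d)) γ s u)
    (hs : UniqueMDiffWithinAt 𝓘(ℝ, ℝ) s u) :
    ((mfderivWithin 𝓘(ℝ, ℝ) (𝓘(ℝ, ℝ).prod (𝓡 d)) γ s u (1 : ℝ)).1 : ℝ) =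
      derivWithin (timeOf γ) s u := by
  have h1 := (hasMFDerivAt_timeAxis_val (γ u).1).comp (γ u)
    (hasMFDerivAt_fst (I := 𝓘(ℝ, ℝ)) (I' := 𝓡 d) (x := γ u))
  have h2 := h1.comp_hasMFDerivWithinAt u hγ.hasMFDerivWithinAt
  have h3 : HasFDerivWithinAt (timeOf γ) (_ : ℝ →L[ℝ] ℝ) s u :=
    hasMFDerivWithinAt_iff_hasFDerivWithinAt.1 h2
  exact (h3.hasDerivWithinAt.derivWithin (uniqueMDiffWithinAt_iff_uniqueDiffWithinAt.1 hs)).symm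

lemma ChordGeometry.mfderivWithin_snd_eq (G : ChordGeometry h V) {γ : ℝ → TimeAxis × N}
    {s : Set ℝ} {u : ℝ}
    (hγ : MDifferentiableWithinAt 𝓘(ℝ, ℝ) (𝓘(ℝ, ℝ).prod (𝓡 d)) γ s u)
    (hs : UniqueMDiffWithinAt 𝓘(ℝ, ℝ) s u) :
    mfderiv (𝓡 d) 𝓘(ℝ, V) G.ι (γ u).2
      (mfderivWithin 𝓘(ℝ, ℝ) (𝓘(ℝ, ℝ).prod (𝓡 d)) γ s u (1 : ℝ)).2 =
      derivWithin (G.pos γ) s u := by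
  have h1 := ((G.contMDiff_ι.mdifferentiable (by simp)) (γ u).2).hasMFDerivAt.comp (γ u)
    (hasMFDerivAt_snd (I := 𝓘(ℝ, ℝ)) (I' := 𝓡 d) (x := γ u))
  have h2 := h1.comp_hasMFDerivWithinAt u hγ.hasMFDerivWithinAt
  have h3 : HasFDerivWithinAt (G.pos γ) (_ : ℝ →L[ℝ] V) s u :=
    hasMFDerivWithinAt_iff_hasFDerivWithinAt.1 h2
  exact (h3.hasDerivWithinAt.derivWithin (uniqueMDiffWithinAt_iff_uniqueDiffWithinAt.1 hs)).symm

/-- This replaces manifold derivatives by ordinary derivatives of the time coordinate and of the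
ambient position, in which all estimates are made. -/
lemma ChordGeometry.isPiece_iff (G : ChordGeometry h V) {γ : ℝ → TimeAxis × N} {α β : ℝ} :
    IsPiece (warpedMetric a h) (timeField d N) γ α β ↔
      α < β ∧ ContMDiffOn 𝓘(ℝ, ℝ) (𝓘(ℝ, ℝ).prod (𝓡 d)) ∞ γ (Icc α β) ∧
      ∀ u ∈ Icc α β, 0 < derivWithin (timeOf γ) (Icc α β) u ∧
        a (timeOf γ u) ^ 2 * G.Q (G.pos γ u) (derivWithin (G.pos γ) (Icc α β) u) <
          derivWithin (timeOf γ) (Icc α β) u ^ 2 := by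
  refine and_congr_right fun hab => and_congr_right fun hγ => forall₂_congr fun u hu => ?_
  have hd : MDifferentiableWithinAt 𝓘(ℝ, ℝ) (𝓘(ℝ, ℝ).prod (𝓡 d)) γ (Icc α β) u :=
    (hγ u hu).mdifferentiableWithinAt (by simp)
  have hU := uniqueMDiffWithinAt_Icc hab hu
  rw [isFutureTimelike_warped_iff, mfderivWithin_fst_eq hd hU]
  have e := (G.metric_eq (γ u).2 _).trans
    (congrArg (G.Q (G.ι (γ u).2)) (G.mfderivWithin_snd_eq hd hU))
  exact Iff.of_eq (congrArg (fun z => 0 < derivWithin (timeOf γ) (Icc α β) u ∧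
    a (timeOf γ u) ^ 2 * z < derivWithin (timeOf γ) (Icc α β) u ^ 2) e)

lemma IsPiece.strictMonoOn_timeOf {γ : ℝ → TimeAxis × N} {α β : ℝ}
    (hγ : IsPiece (warpedMetric a h) (timeField d N) γ α β) (G : ChordGeometry h V) :
    StrictMonoOn (timeOf γ) (Icc α β) := by
  rw [G.isPiece_iff] at hγ
  refine strictMonoOn_of_deriv_pos (convex_Icc α β) (contDiffOn_timeOf hγ.2.1).continuousOn ?_
  intro u hu
  rw [interior_Icc] at hu
  rw [← derivWithin_of_mem_nhds (Icc_mem_nhds hu.1 hu.2)]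
  exact (hγ.2.2 u (Ioo_subset_Icc_self hu)).1

lemma IsTimelikeOn.strictMonoOn_timeOf {γ : ℝ → TimeAxis × N} {α β : ℝ}
    (hγ : IsTimelikeOn (warpedMetric a h) (timeField d N) γ α β) (G : ChordGeometry h V) :
    StrictMonoOn (timeOf γ) (Icc α β) := by
  induction hγ with
  | single h => exact h.strictMonoOn_timeOf G
  | @tail b c h h' ih =>
    have hab := (IsTimelikeOn.lt h).le
    rw [← Icc_union_Icc_eq_Icc hab h'.1.le]
    exact ih.union (h'.strictMonoOn_timeOf G) (isGreatest_Icc hab) (isLeast_Icc h'.1.le)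

/-- One-sided derivatives to the right of a timelike curve, with a uniform gap in the timelike
condition. -/
lemma IsTimelikeOn.exists_uniform {γ : ℝ → TimeAxis × N} {α β : ℝ}
    (hγ : IsTimelikeOn (warpedMetric a h) (timeField d N) γ α β) (G : ChordGeometry h V)
    (ha : ContinuousOn a (Ioi 0)) :
    ∃ θ < 1, ∀ u ∈ Ico α β, ∃ (X' : V) (t' : ℝ), HasDerivWithinAt (G.pos γ) X' (Ici u) u ∧
      HasDerivWithinAt (timeOf γ) t' (Ici u) u ∧ 0 < t' ∧
      a (timeOf γ u) ^ 2 * G.Q (G.pos γ u) X' ≤ θ * t' ^ 2 := by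
  have piece : ∀ {α β : ℝ}, IsPiece (warpedMetric a h) (timeField d N) γ α β →
      ∃ θ < 1, ∀ u ∈ Ico α β, ∃ (X' : V) (t' : ℝ), HasDerivWithinAt (G.pos γ) X' (Ici u) u ∧
      HasDerivWithinAt (timeOf γ) t' (Ici u) u ∧ 0 < t' ∧
      a (timeOf γ u) ^ 2 * G.Q (G.pos γ u) X' ≤ θ * t' ^ 2 := by
    intro α β hp
    rw [G.isPiece_iff] at hp
    obtain ⟨hab, hs, hd⟩ := hp
    have ht := contDiffOn_timeOf hs
    have hX := G.contDiffOn_pos hs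
    have hU := uniqueDiffOn_Icc hab
    -- This ratio is below `1` at every point of the compact piece, hence so is its maximum, which
    -- serves as `θ`.
    have hc : ContinuousOn (fun u => a (timeOf γ u) ^ 2 *
        G.Q (G.pos γ u) (derivWithin (G.pos γ) (Icc α β) u) /
          derivWithin (timeOf γ) (Icc α β) u ^ 2) (Icc α β) := by
      refine ContinuousOn.div (ContinuousOn.mul (ContinuousOn.pow ?_ 2) ?_)
        ((ht.continuousOn_derivWithin hU (by simp)).pow 2) fun u hu =>
          (pow_pos (hd u hu).1 2).ne'
      · exact ha.comp ht.continuousOn fun u _ => (γ u).1.2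
      · exact G.continuous_Q.comp_continuousOn
          (hX.continuousOn.prodMk (hX.continuousOn_derivWithin hU (by simp)))
    obtain ⟨m, hm, hmax⟩ := isCompact_Icc.exists_isMaxOn (nonempty_Icc.2 hab.le) hc
    refine ⟨_, (div_lt_one (pow_pos (hd m hm).1 2)).2 (hd m hm).2, fun u hu => ?_⟩
    have hu' := Ico_subset_Icc_self hu
    exact ⟨_, _, hX.hasDerivWithinAt_Ici hu, ht.hasDerivWithinAt_Ici hu, (hd u hu').1,
      (div_le_iff₀ (pow_pos (hd u hu').1 2)).1 (hmax hu')⟩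
  induction hγ with
  | single h => exact piece h
  | @tail b c h h' ih =>
    obtain ⟨θ, hθ, H⟩ := ih
    obtain ⟨θ', hθ', H'⟩ := piece h'
    refine ⟨max θ θ', max_lt hθ hθ', fun u hu => ?_⟩
    rcases lt_or_ge u b with hb | hb
    · obtain ⟨X', t', h1, h2, h3, h4⟩ := H u ⟨hu.1, hb⟩
      exact ⟨X', t', h1, h2, h3, h4.trans
        (mul_le_mul_of_nonneg_right (le_max_left _ _) (sq_nonneg _))⟩
    · obtain ⟨X', t', h1, h2, h3, h4⟩ := H' u ⟨hb, hu.2⟩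
      exact ⟨X', t', h1, h2, h3, h4.trans
        (mul_le_mul_of_nonneg_right (le_max_right _ _) (sq_nonneg _))⟩

/-- The segment between two events, affine in time. -/
def ChordGeometry.segment (G : ChordGeometry h V) (P P' : TimeAxis × N) (s : ℝ) : TimeAxis × N :=
  (toTime ((1 - s) * P.1 + s * P'.1), G.seg P.2 P'.2 s)

lemma convexComb_pos (t t' : TimeAxis) {s : ℝ} (hs : s ∈ Icc (0 : ℝ) 1) :
    0 < (1 - s) * (t : ℝ) + s * t' := by
  have h1 : (0 : ℝ) < t := t.2
  have h2 : (0 : ℝ) < t' := t'.2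
  rcases hs.1.eq_or_lt with rfl | h
  · simpa using h1
  · have := mul_nonneg (sub_nonneg.2 hs.2) h1.le
    have := mul_pos h h2
    linarith

lemma ChordGeometry.segment_zero (G : ChordGeometry h V) {P P' : TimeAxis × N}
    (hF : G.F P.2 P'.2 < G.ε₀) : G.segment P P' 0 = P := by
  ext1
  · simp [segment, toTime_coe]
  · exact G.seg_zero _ _ hF

lemma ChordGeometry.segment_one (G : ChordGeometry h V) {P P' : TimeAxis × N}
    (hF : G.F P.2 P'.2 < G.ε₀) : G.segment P P' 1 = P' := by
  ext1
  · simp [segment, toTime_coe]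
  · exact G.seg_one _ _ hF

lemma ChordGeometry.segment_self (G : ChordGeometry h V) (P : TimeAxis × N) {s : ℝ}
    (hs : s ∈ Icc (0 : ℝ) 1) : G.segment P P s = P := by
  ext1
  · have : (1 - s) * (P.1 : ℝ) + s * P.1 = P.1 := by ring
    simp only [segment, this, toTime_coe]
  · exact G.seg_self _ s hs

lemma ChordGeometry.continuousOn_segment (G : ChordGeometry h V) :
    ContinuousOn (fun z : ((TimeAxis × N) × (TimeAxis × N)) × ℝ => G.segment z.1.1 z.1.2 z.2)
      {z | G.F z.1.1.2 z.1.2.2 < G.ε₀ ∧ z.2 ∈ Icc (0 : ℝ) 1} := by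
  refine ContinuousOn.prodMk ?_ ?_
  · refine continuousOn_toTime.comp (by fun_prop) fun z hz => convexComb_pos _ _ hz.2
  · exact G.continuousOn_seg.comp
      (f := fun z : ((TimeAxis × N) × (TimeAxis × N)) × ℝ => ((z.1.1.2, z.1.2.2), z.2))
      (by fun_prop) fun z hz => hz

/-- The time component of the velocity is the constant `P'.1 - P.1`, so a bound `B` on the squared
spatial speed is all that is needed. -/
lemma ChordGeometry.isTimelikeOn_segment (G : ChordGeometry h V) {P P' : TimeAxis × N} {B : ℝ}
    (hF : G.F P.2 P'.2 < G.ε₀) (ht : (P.1 : ℝ) < P'.1)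
    (hB : ∀ s ∈ Icc (0 : ℝ) 1, G.Q (G.ι (G.seg P.2 P'.2 s))
      (derivWithin (fun s => G.ι (G.seg P.2 P'.2 s)) (Icc 0 1) s) ≤ B)
    (haB : ∀ t ∈ Icc (P.1 : ℝ) P'.1, a t ^ 2 * B < ((P'.1 : ℝ) - P.1) ^ 2) :
    IsTimelikeOn (warpedMetric a h) (timeField d N) (G.segment P P') 0 1 := by
  have htime : ∀ s ∈ Icc (0 : ℝ) 1,
      timeOf (G.segment P P') s = (1 - s) * (P.1 : ℝ) + s * P'.1 := fun s hs =>
    coe_toTime (convexComb_pos _ _ hs)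
  refine .single (G.isPiece_iff.2 ⟨one_pos, ?_, fun s hs => ?_⟩)
  · refine ContMDiffOn.prodMk ?_ (G.contMDiffOn_seg _ _ hF)
    refine contMDiffOn_toTime.comp ?_ fun s hs => convexComb_pos P.1 P'.1 hs
    exact (ContDiff.contMDiff (by fun_prop)).contMDiffOn
  · have hd : derivWithin (timeOf (G.segment P P')) (Icc 0 1) s = (P'.1 : ℝ) - P.1 := by
      refine HasDerivWithinAt.derivWithin ?_ (uniqueDiffOn_Icc one_pos s hs)
      have h1 : HasDerivAt (fun s : ℝ => (1 - s) * (P.1 : ℝ) + s * P'.1) ((P'.1 : ℝ) - P.1) s := by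
        exact ((((hasDerivAt_id' s).const_sub 1).mul_const (P.1 : ℝ)).add
          ((hasDerivAt_id' s).mul_const (P'.1 : ℝ))).congr_deriv (by ring)
      exact h1.hasDerivWithinAt.congr htime (htime s hs)
    rw [hd]
    refine ⟨sub_pos.2 ht, ?_⟩
    have hmem : timeOf (G.segment P P') s ∈ Icc (P.1 : ℝ) P'.1 := by
      rw [htime s hs]
      have h1 := mul_nonneg hs.1 (sub_nonneg.2 ht.le)
      have h2 := mul_nonneg (sub_nonneg.2 hs.2) (sub_nonneg.2 ht.le)
      constructor <;> linarith
    exact (mul_le_mul_of_nonneg_left (hB s hs) (sq_nonneg _)).trans_lt (haB _ hmem)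

end Warped

/-! ### Coning off, and deformation of polygons -/

section Polygons

variable {d : ℕ} {N : Type*} [TopologicalSpace N] [ChartedSpace (EuclideanSpace ℝ (Fin d)) N]
  {a : ℝ → ℝ} {h : TensorField (𝓡 d) N}
  {V : Type*} [NormedAddCommGroup V] [NormedSpace ℝ V]

/-- A timelike curve all of whose initial pieces span short timelike segments can be coned off to
the segment between its endpoints. -/
lemma ChordGeometry.isHomotopic_segment (G : ChordGeometry h V) {γ : ℝ → TimeAxis × N}
    (hγ : IsTimelikeOn (warpedMetric a h) (timeField d N) γ 0 1)
    (hs : ∀ r ∈ Ioc (0 : ℝ) 1, G.F (γ 0).2 (γ r).2 < G.ε₀ ∧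
      IsTimelikeOn (warpedMetric a h) (timeField d N) (G.segment (γ 0) (γ r)) 0 1) :
    IsHomotopic (warpedMetric a h) (timeField d N) γ (G.segment (γ 0) (γ 1)) := by
  have hF : ∀ r ∈ Icc (0 : ℝ) 1, G.F (γ 0).2 (γ r).2 < G.ε₀ := by
    intro r hr
    rcases hr.1.eq_or_lt with rfl | h0
    · rw [G.F_self]; exact G.ε₀_pos
    · exact (hs r ⟨h0, hr.2⟩).1
  have hmax : ∀ z ∈ Icc (0 : ℝ) 1 ×ˢ Icc (0 : ℝ) 1, max z.1 z.2 ∈ Icc (0 : ℝ) 1 := fun z hz =>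
    ⟨le_max_of_le_left hz.1.1, max_le hz.1.2 hz.2.2⟩
  have hdiv : ∀ z ∈ Icc (0 : ℝ) 1 ×ˢ Icc (0 : ℝ) 1, z.2 / max z.1 z.2 ∈ Icc (0 : ℝ) 1 :=
    fun z hz => ⟨div_nonneg hz.2.1 (hmax z hz).1, div_le_one_of_le₀ (le_max_right _ _) (hmax z hz).1⟩
  -- Stage `r` runs along the segment from `γ 0` to `γ r` for `s ≤ r` and along `γ` afterwards;
  -- `max` merges the two cases. At the corner `(0, 0)` the quotient is `0 / 0 = 0`, and the segment
  -- is constant.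
  set Γ : ℝ × ℝ → TimeAxis × N :=
    fun z => G.segment (γ 0) (γ (max z.1 z.2)) (z.2 / max z.1 z.2) with hΓ
  have hge : ∀ r s : ℝ, r ∈ Icc (0 : ℝ) 1 → s ∈ Icc (0 : ℝ) 1 → r ≤ s → Γ (r, s) = γ s := by
    intro r s hr hs' hrs
    simp only [hΓ, max_eq_right hrs]
    rcases hs'.1.eq_or_lt with rfl | h0
    · rw [G.segment_self _ (by simp)]
    · rw [div_self h0.ne', G.segment_one (hF s hs')]
  have hle : ∀ r s : ℝ, s ≤ r → Γ (r, s) = G.segment (γ 0) (γ r) (s / r) := by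
    intro r s hrs
    simp only [hΓ, max_eq_left hrs]
  have hcont : ContinuousOn Γ (Icc 0 1 ×ˢ Icc 0 1) := by
    intro z hz
    by_cases hz0 : max z.1 z.2 = 0
    · have h1 : z.1 = 0 := le_antisymm (hz0 ▸ le_max_left _ _) hz.1.1
      have h2 : z.2 = 0 := le_antisymm (hz0 ▸ le_max_right _ _) hz.2.1
      obtain ⟨r, s⟩ := z
      simp only at h1 h2
      subst h1 h2
      intro U hU
      rw [hge 0 0 hz.1 hz.2 le_rfl] at hU
      -- At the corner `s / max r s` has no limit but stays in the compact interval `[0, 1]`. By a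
      -- tube argument, the whole segment to a point near `γ 0` lies in `U`.
      have key : ∀ᶠ P in 𝓝 (γ 0), ∀ s ∈ Icc (0 : ℝ) 1,
          (G.F (γ 0).2 P.2 < G.ε₀ ∧ s ∈ Icc (0 : ℝ) 1) → G.segment (γ 0) P s ∈ U := by
        refine isCompact_Icc.eventually_forall_of_forall_eventually fun s hs => ?_
        have hD : ((γ 0, γ 0), s) ∈ {z : ((TimeAxis × N) × (TimeAxis × N)) × ℝ |
            G.F z.1.1.2 z.1.2.2 < G.ε₀ ∧ z.2 ∈ Icc (0 : ℝ) 1} := ⟨hF 0 (by simp), hs⟩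
        have hc := G.continuousOn_segment _ hD
        have hU' : U ∈ 𝓝 (G.segment (γ 0) (γ 0) s) := by rwa [G.segment_self _ hs]
        have he := eventually_nhdsWithin_iff.1 (hc.eventually_mem hU')
        have hm : Tendsto (fun w : (TimeAxis × N) × ℝ => ((γ 0, w.1), w.2)) (𝓝 (γ 0, s))
            (𝓝 ((γ 0, γ 0), s)) := Continuous.tendsto' (by fun_prop) _ _ rfl
        filter_upwards [hm.eventually he] with w hw hw'
        exact hw hw'
      have hm : Tendsto (fun z : ℝ × ℝ => max z.1 z.2) (𝓝[Icc 0 1 ×ˢ Icc 0 1] (0, 0))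
          (𝓝[Icc 0 1] 0) := by
        refine tendsto_nhdsWithin_iff.2 ⟨?_, eventually_mem_nhdsWithin.mono hmax⟩
        exact (Continuous.tendsto' (by fun_prop) _ _ (by simp)).mono_left nhdsWithin_le_nhds
      have hγ0 := (hγ.continuousOn 0 (by simp)).tendsto.comp hm
      refine mem_map.2 ?_
      filter_upwards [hγ0.eventually key, eventually_mem_nhdsWithin] with z hz hz'
      exact hz _ (hdiv z hz') ⟨hF _ (hmax z hz'), hdiv z hz'⟩
    · have h1 : ContinuousWithinAt (fun z : ℝ × ℝ => γ (max z.1 z.2)) (Icc 0 1 ×ˢ Icc 0 1) z :=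
        (hγ.continuousOn _ (hmax z hz)).comp (f := fun z : ℝ × ℝ => max z.1 z.2)
          (by fun_prop) hmax
      have h2 : ContinuousWithinAt (fun z : ℝ × ℝ => z.2 / max z.1 z.2) (Icc 0 1 ×ˢ Icc 0 1) z :=
        ContinuousWithinAt.div (by fun_prop) (by fun_prop) hz0
      exact (G.continuousOn_segment _ ⟨hF _ (hmax z hz), hdiv z hz⟩).comp
        (f := fun z : ℝ × ℝ => ((γ 0, γ (max z.1 z.2)), z.2 / max z.1 z.2))
        ((continuousWithinAt_const.prodMk h1).prodMk h2)
        fun w hw => ⟨hF _ (hmax w hw), hdiv w hw⟩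
  refine ⟨Γ, ⟨hcont, fun r hr => ?_⟩, fun r hr => ⟨?_, ?_⟩, fun s hs' => ?_, fun s hs' => ?_⟩
  · rcases hr.1.eq_or_lt with rfl | h0
    · exact hγ.congr fun s hs' => hge 0 s hr hs' hs'.1
    · have hL : IsTimelikeOn (warpedMetric a h) (timeField d N) (fun s => Γ (r, s)) 0 r := by
        refine ((hs r ⟨h0, hr.2⟩).2.comp_affine (k := r⁻¹) (c := 0) (a := 0) (b := r)
          (inv_pos.2 h0) (by simp) (by field_simp; simp)).congr fun s hs' => ?_
        rw [hle r s hs'.2, add_zero, inv_mul_eq_div]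
      rcases hr.2.eq_or_lt with rfl | h1
      · exact hL
      · exact Relation.TransGen.trans hL ((hγ.right hr.1 h1).congr fun s hs' =>
          hge r s hr ⟨hr.1.trans hs'.1, hs'.2⟩ hs'.1)
  · rw [hle r 0 hr.1, zero_div, G.segment_zero (hF r hr)]
  · exact hge r 1 hr (by simp) hr.2
  · exact hge 0 s (by simp) hs' hs'.1
  · rw [hle 1 s hs'.2, div_one]

lemma ChordGeometry.isTimelikeFamily_segment (G : ChordGeometry h V) {A B : ℝ → TimeAxis × N}
    (hA : ContinuousOn A (Icc 0 1)) (hB : ContinuousOn B (Icc 0 1))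
    (hs : ∀ r ∈ Icc (0 : ℝ) 1, G.F (A r).2 (B r).2 < G.ε₀ ∧
      IsTimelikeOn (warpedMetric a h) (timeField d N) (G.segment (A r) (B r)) 0 1) :
    IsTimelikeFamily (warpedMetric a h) (timeField d N)
      (fun z => G.segment (A z.1) (B z.1) z.2) := by
  refine ⟨?_, fun r hr => (hs r hr).2⟩
  refine G.continuousOn_segment.comp (f := fun z : ℝ × ℝ => ((A z.1, B z.1), z.2)) ?_
    fun z hz => ⟨(hs _ hz.1).1, hz.2⟩
  exact ((hA.comp continuousOn_fst fun z hz => hz.1).prodMk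
    (hB.comp continuousOn_fst fun z hz => hz.1)).prodMk continuousOn_snd

/-- Time levels `τ i` and slopes `κ i` such that, in the slab between `τ i` and `τ (i + 1)`, events
whose chord is shorter than `κ i` times their time difference are joined by a timelike segment. -/
structure ChordGeometry.IsGrid (G : ChordGeometry h V) (a : ℝ → ℝ) (τ : ℕ → TimeAxis)
    (κ : ℕ → ℝ) : Prop where
  lt_succ : ∀ i, (τ i : ℝ) < τ (i + 1)
  κ_pos : ∀ i, 0 < κ i
  radius_le : ∀ i, (κ i * ((τ (i + 1) : ℝ) - τ i)) ^ 2 ≤ G.ε₀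
  step : ∀ (i : ℕ) (P P' : TimeAxis × N), (τ i : ℝ) ≤ P.1 → (P.1 : ℝ) < P'.1 →
    (P'.1 : ℝ) ≤ τ (i + 1) → G.F P.2 P'.2 < (κ i * ((P'.1 : ℝ) - P.1)) ^ 2 →
    G.F P.2 P'.2 < G.ε₀ ∧
      IsTimelikeOn (warpedMetric a h) (timeField d N) (G.segment P P') 0 1

/-- The squared chord length allowed in the `i`-th slab. -/
def radius (τ : ℕ → TimeAxis) (κ : ℕ → ℝ) (i : ℕ) : ℝ :=
  (κ i * ((τ (i + 1) : ℝ) - τ i)) ^ 2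

/-- Curves from `(τ 0, p)` to `(τ (n + 1), v)` made of one short segment in each slab. -/
inductive ChordGeometry.IsPolygon (G : ChordGeometry h V) (τ : ℕ → TimeAxis) (κ : ℕ → ℝ) (p : N) :
    ℕ → N → (ℝ → TimeAxis × N) → Prop
  | base (v : N) (hv : G.F p v < radius τ κ 0) :
      IsPolygon G τ κ p 0 v (G.segment (τ 0, p) (τ 1, v))
  | step (n : ℕ) (v w : N) (β : ℝ → TimeAxis × N) (hβ : IsPolygon G τ κ p n v β)
      (hw : G.F v w < radius τ κ (n + 1)) :
      IsPolygon G τ κ p (n + 1) w (concat β (G.segment (τ (n + 1), v) (τ (n + 2), w)))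

variable {G : ChordGeometry h V} {τ : ℕ → TimeAxis} {κ : ℕ → ℝ} {p : N}

lemma ChordGeometry.IsGrid.radius_pos (hG : G.IsGrid a τ κ) (i : ℕ) : 0 < radius τ κ i :=
  pow_pos (mul_pos (hG.κ_pos i) (sub_pos.2 (hG.lt_succ i))) 2

lemma ChordGeometry.IsGrid.segment (hG : G.IsGrid a τ κ) {i : ℕ} {u v : N}
    (hv : G.F u v < radius τ κ i) : G.F u v < G.ε₀ ∧
      IsTimelikeOn (warpedMetric a h) (timeField d N) (G.segment (τ i, u) (τ (i + 1), v)) 0 1 :=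
  hG.step i (τ i, u) (τ (i + 1), v) le_rfl (hG.lt_succ i) le_rfl hv

lemma ChordGeometry.IsPolygon.spec (hG : G.IsGrid a τ κ) {n : ℕ} {v : N} {β : ℝ → TimeAxis × N}
    (hβ : G.IsPolygon τ κ p n v β) :
    IsTimelikeOn (warpedMetric a h) (timeField d N) β 0 1 ∧ β 1 = (τ (n + 1), v) := by
  induction hβ with
  | base v hv => exact ⟨(hG.segment hv).2, G.segment_one (hG.segment hv).1⟩
  | step n v w β hβ hw ih =>
    have hs := hG.segment hw
    refine ⟨ih.1.concat hs.2 ?_, ?_⟩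
    · rw [ih.2, G.segment_zero hs.1]
    · rw [concat_one, G.segment_one hs.1]

/-- The end vertex of a polygon can be moved a little, keeping all other vertices. -/
lemma ChordGeometry.IsPolygon.eventually_move [LocallyPathConnectedSpace N] (hG : G.IsGrid a τ κ)
    {n : ℕ} {x : N} {β : ℝ → TimeAxis × N} (hβ : G.IsPolygon τ κ p n x β) {U : Set N}
    (hU : U ∈ 𝓝 x) :
    ∀ᶠ y in 𝓝 x, ∃ (β' : ℝ → TimeAxis × N) (ρ : ℝ → N) (Γ : ℝ × ℝ → TimeAxis × N),
      G.IsPolygon τ κ p n y β' ∧ ContinuousOn ρ (Icc 0 1) ∧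
      IsTimelikeFamily (warpedMetric a h) (timeField d N) Γ ∧
      (∀ r ∈ Icc (0 : ℝ) 1, ρ r ∈ U ∧ Γ (r, 0) = β 0 ∧ Γ (r, 1) = (τ (n + 1), ρ r)) ∧
      ρ 0 = x ∧ ρ 1 = y ∧ (∀ s ∈ Icc (0 : ℝ) 1, Γ (0, s) = β s) ∧
      ∀ s ∈ Icc (0 : ℝ) 1, Γ (1, s) = β' s := by
  -- Local path connectedness joins `x` to `y` by a path that keeps both constraints: staying in `U`
  -- and within reach of the previous vertex `u`.
  have key : ∀ (u : N) (i : ℕ), G.F u x < radius τ κ i → ∀ᶠ y in 𝓝 x, ∃ ρ : ℝ → N,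
      ContinuousOn ρ (Icc 0 1) ∧ (∀ r, ρ r ∈ U ∧ G.F u (ρ r) < radius τ κ i) ∧
      ρ 0 = x ∧ ρ 1 = y := by
    intro u i hu
    have hW : U ∩ {y | G.F u y < radius τ κ i} ∈ 𝓝 x := by
      refine inter_mem hU ((isOpen_lt ?_ continuous_const).mem_nhds hu)
      exact G.continuous_F.comp (f := fun y => (u, y)) (by fun_prop)
    obtain ⟨W, ⟨hW1, hW2⟩, hW3⟩ := (LocallyPathConnectedSpace.path_connected_basis x).mem_iff.1 hW
    filter_upwards [hW1] with y hy
    have hj := hW2.joinedIn x (mem_of_mem_nhds hW1) y hy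
    refine ⟨hj.somePath.extend, hj.somePath.continuous_extend.continuousOn, fun r => ?_,
      by simp, by simp⟩
    exact hW3 (hj.somePath_mem (projIcc 0 1 zero_le_one r))
  cases hβ with
  | base x hx =>
    filter_upwards [key p 0 hx] with y ⟨ρ, hρ, hρU, h0, h1⟩
    have hs := fun r => hG.segment (hρU r).2
    refine ⟨_, ρ, _, .base y (h1 ▸ (hρU 1).2), hρ,
      G.isTimelikeFamily_segment (A := fun _ => (τ 0, p)) (B := fun r => (τ 1, ρ r))
        continuousOn_const (continuousOn_const.prodMk hρ) fun r _ => hs r,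
      fun r _ => ⟨(hρU r).1, ?_, ?_⟩, h0, h1, fun s _ => ?_, fun s _ => ?_⟩
    · have h2 := hs 0
      rw [h0] at h2
      exact (G.segment_zero (P := (τ 0, p)) (P' := (τ 1, ρ r)) (hs r).1).trans
        (G.segment_zero (P := (τ 0, p)) (P' := (τ 1, x)) h2.1).symm
    · exact G.segment_one (P := (τ 0, p)) (P' := (τ 1, ρ r)) (hs r).1
    · simp only [h0]
    · simp only [h1]
  | step n v x α hα hx =>
    filter_upwards [key v (n + 1) hx] with y ⟨ρ, hρ, hρU, h0, h1⟩
    have hs := fun r => hG.segment (hρU r).2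
    have hc : ∀ r, α 1 = G.segment (τ (n + 1), v) (τ (n + 2), ρ r) 0 := fun r => by
      rw [(hα.spec hG).2, G.segment_zero (hs r).1]
    have hαF : IsTimelikeFamily (warpedMetric a h) (timeField d N)
        (fun z : ℝ × ℝ => α z.2) :=
      ⟨(hα.spec hG).1.continuousOn.comp continuousOn_snd fun z hz => hz.2,
        fun _ _ => (hα.spec hG).1⟩
    refine ⟨_, ρ, _, .step n v y α hα (h1 ▸ (hρU 1).2), hρ,
      hαF.concat (G.isTimelikeFamily_segment (A := fun _ => (τ (n + 1), v))
        (B := fun r => (τ (n + 2), ρ r)) continuousOn_const (continuousOn_const.prodMk hρ)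
        fun r _ => hs r) fun r _ => hc r,
      fun r _ => ⟨(hρU r).1, by simp, ?_⟩, h0, h1, fun s _ => ?_, fun s _ => ?_⟩
    · rw [concat_one]
      exact G.segment_one (P := (τ (n + 1), v)) (P' := (τ (n + 2), ρ r)) (hs r).1
    · simp only [h0]
    · simp only [h1]

/-- Polygons with the same endpoints are homotopic, if the possible positions of the last vertex
form a preconnected set. -/
lemma ChordGeometry.IsPolygon.isHomotopic [LocallyPathConnectedSpace N] (hG : G.IsGrid a τ κ)
    (hconn : ∀ n w, IsPreconnected
      {v | (∃ β, G.IsPolygon τ κ p n v β) ∧ G.F v w < radius τ κ (n + 1)})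
    {n : ℕ} {w : N} {β β' : ℝ → TimeAxis × N} (hβ : G.IsPolygon τ κ p n w β)
    (hβ' : G.IsPolygon τ κ p n w β') :
    IsHomotopic (warpedMetric a h) (timeField d N) β β' := by
  induction n generalizing w β β' with
  | zero => cases hβ; cases hβ'; exact .refl (hG.segment ‹_›).2
  | succ n ih =>
    cases hβ with
    | step _ v _ α hα hv =>
    cases hβ' with
    | step _ v' _ α' hα' hv' =>
    set S : N → ℝ → TimeAxis × N := fun v => G.segment (τ (n + 1), v) (τ (n + 2), w) with hS
    have join : ∀ {v β}, G.IsPolygon τ κ p n v β → G.F v w < radius τ κ (n + 1) →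
        β 1 = S v 0 := by
      intro v β hβ hv
      rw [(hβ.spec hG).2, hS]
      exact (G.segment_zero (hG.segment hv).1).symm
    -- On a preconnected set a transitive symmetric relation that holds locally holds everywhere.
    -- Quantifying over all polygons to `v` and `v'` lets the chosen polygons change along the way.
    let P : N → N → Prop := fun v v' => ∀ β β', G.IsPolygon τ κ p n v β →
      G.IsPolygon τ κ p n v' β' →
        IsHomotopic (warpedMetric a h) (timeField d N) (concat β (S v)) (concat β' (S v'))
    refine (hconn n w).induction₂ P ?_ ?_ ?_ ⟨⟨α, hα⟩, hv⟩ ⟨⟨α', hα'⟩, hv'⟩ α α' hα hα'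
    · rintro x ⟨⟨β, hβ⟩, hx⟩
      have hU : {y | G.F y w < radius τ κ (n + 1)} ∈ 𝓝 x := by
        refine (isOpen_lt ?_ continuous_const).mem_nhds hx
        exact G.continuous_F.comp (f := fun y => (y, w)) (by fun_prop)
      refine Eventually.filter_mono nhdsWithin_le_nhds ?_
      filter_upwards [hβ.eventually_move hG hU] with y ⟨β', ρ, Γ, hβ', hρ, hΓ, hρ2, h0, h1, k0, k1⟩
      have hy : G.F y w < radius τ κ (n + 1) := h1 ▸ (hρ2 1 (by simp)).1
      have hom : IsHomotopic (warpedMetric a h) (timeField d N) (concat β (S x))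
          (concat β' (S y)) := by
        have hs : ∀ r ∈ Icc (0 : ℝ) 1, _ := fun r hr => hG.segment (hρ2 r hr).1
        have e : ∀ r ∈ Icc (0 : ℝ) 1, Γ (r, 1) = S (ρ r) 0 := fun r hr => by
          rw [(hρ2 r hr).2.2]; exact (G.segment_zero (hs r hr).1).symm
        have hfam : IsTimelikeFamily (warpedMetric a h) (timeField d N)
            (fun z : ℝ × ℝ => S (ρ z.1) z.2) :=
          G.isTimelikeFamily_segment (A := fun r => (τ (n + 1), ρ r))
            (B := fun _ => (τ (n + 2), w)) (continuousOn_const.prodMk hρ) continuousOn_const hs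
        refine ⟨_, hΓ.concat hfam e, fun r hr => ⟨?_, ?_⟩, fun s hs' => ?_, fun s hs' => ?_⟩
        · simp only [concat_zero, (hρ2 r hr).2.1]
        · simp only [concat_one, hS]
          rw [G.segment_one (hs r hr).1, G.segment_one (hG.segment hx).1]
        · rcases le_total s (1 / 2) with h | h
          · simp only [concat_of_le h]
            exact k0 _ ⟨by linarith [hs'.1], by linarith⟩
          · rw [concat_of_ge (e 0 (by simp)) h, concat_of_ge (join hβ hx) h]
            simp only [h0]
        · rcases le_total s (1 / 2) with h | h
          · simp only [concat_of_le h]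
            exact k1 _ ⟨by linarith [hs'.1], by linarith⟩
          · rw [concat_of_ge (e 1 (by simp)) h, concat_of_ge (join hβ' hy) h]
            simp only [h1]
      -- Three homotopies: replace `δ` by `β` using the induction hypothesis, move the vertex from
      -- `x` to `y`, replace `β'` by `δ'`.
      intro δ δ' hδ hδ'
      have h1 := (ih hδ hβ).concat (.refl (hG.segment hx).2) (join hδ hx)
      have h2 := (ih hβ' hδ').concat (.refl (hG.segment hy).2) (join hβ' hy)
      exact (h1.trans hom).trans h2
    · rintro x y z - ⟨⟨β, hβ⟩, -⟩ - hxy hyz δ δ' hδ hδ'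
      exact (hxy δ β hδ hβ).trans (hyz β δ' hβ hδ')
    · intro x y _ _ hxy δ δ' hδ hδ'
      exact (hxy δ' δ hδ' hδ).symm

/-- The vertices reachable by polygons form an `F`-ball around `p`, and these balls intersect small
`F`-balls in preconnected sets. -/
lemma ChordGeometry.IsGrid.isPreconnected_reachable (hG : G.IsGrid a τ κ) (n : ℕ) (w : N) :
    IsPreconnected {v | (∃ β, G.IsPolygon τ κ p n v β) ∧ G.F v w < radius τ κ (n + 1)} := by
  have hball : ∀ (v : N) (i : ℕ), IsPreconnected {x | G.F v x < radius τ κ i} := fun v i => by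
    simpa using G.isPreconnected_inter v v univ (radius τ κ i) ordConnected_univ (mem_univ _)
      (hG.radius_le i)
  -- Preconnectedness and the presence of `p` are carried through the induction because they make
  -- the set of values of `F p` an interval containing `0`.
  have key : ∀ n, IsPreconnected {v | ∃ β, G.IsPolygon τ κ p n v β} ∧
      (∃ β, G.IsPolygon τ κ p n p β) ∧
      ∃ J : Set ℝ, J.OrdConnected ∧ 0 ∈ J ∧ ∀ v, (∃ β, G.IsPolygon τ κ p n v β) ↔ G.F p v ∈ J := by
    intro n
    induction n with
    | zero =>
      have e : ∀ v, (∃ β, G.IsPolygon τ κ p 0 v β) ↔ G.F p v < radius τ κ 0 := by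
        refine fun v => ⟨?_, fun hv => ⟨_, .base v hv⟩⟩
        rintro ⟨β, hβ⟩
        cases hβ
        assumption
      refine ⟨by simpa only [e] using hball p 0, (e p).2 ?_, Iio (radius τ κ 0), ordConnected_Iio,
        hG.radius_pos 0, e⟩
      rw [G.F_self]; exact hG.radius_pos 0
    | succ n ih =>
      obtain ⟨hpre, hp, J, hJ, h0, hiff⟩ := ih
      have e : ∀ w, (∃ β, G.IsPolygon τ κ p (n + 1) w β) ↔
          ∃ v, (∃ β, G.IsPolygon τ κ p n v β) ∧ G.F v w < radius τ κ (n + 1) := by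
        refine fun w => ⟨?_, fun ⟨v, ⟨β, hβ⟩, hv⟩ => ⟨_, .step n v w β hβ hv⟩⟩
        rintro ⟨β, hβ⟩
        cases hβ with
        | step _ v _ β hβ hw => exact ⟨v, ⟨β, hβ⟩, hw⟩
      have hself : ∀ v, G.F v v < radius τ κ (n + 1) := fun v => by
        rw [G.F_self]; exact hG.radius_pos _
      have hpre' : IsPreconnected {v | ∃ β, G.IsPolygon τ κ p (n + 1) v β} := by
        -- Adding the old reachable set to each ball gives preconnected sets that share the point
        -- `p`.
        have hU : {v | ∃ β, G.IsPolygon τ κ p (n + 1) v β} =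
            ⋃ v : {v | ∃ β, G.IsPolygon τ κ p n v β}, ({v | ∃ β, G.IsPolygon τ κ p n v β} ∪
              {x | G.F v x < radius τ κ (n + 1)}) := by
          ext w
          simp only [mem_ofPred_eq, mem_iUnion, mem_union, e]
          constructor
          · rintro ⟨v, hv, hw⟩; exact ⟨⟨v, hv⟩, Or.inr hw⟩
          · rintro ⟨⟨v, hv⟩, hw | hw⟩
            · exact ⟨w, hw, hself w⟩
            · exact ⟨v, hv, hw⟩
        rw [hU]
        refine isPreconnected_iUnion ⟨p, mem_iInter.2 fun v => Or.inl hp⟩ fun v => ?_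
        exact hpre.union v.1 v.2 (hself v.1) (hball v.1 _)
      refine ⟨hpre', (e p).2 ⟨p, hp, hself p⟩, G.F p '' {v | ∃ β, G.IsPolygon τ κ p (n + 1) v β},
        ?_, ⟨p, (e p).2 ⟨p, hp, hself p⟩, G.F_self p⟩, fun w => ⟨fun hw => ⟨w, hw, rfl⟩, ?_⟩⟩
      · refine (hpre'.image _ (Continuous.continuousOn ?_)).ordConnected
        exact G.continuous_F.comp (f := fun y => (p, y)) (by fun_prop)
      -- Reachability depends only on `F p`: a symmetry fixing `p` and taking `x` to `w` carries the
      -- penultimate vertex `v` to `σ v`, which is reachable because `F p (σ v) = F p v`.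
      · rintro ⟨x, hx, hxw⟩
        obtain ⟨v, hv, hvx⟩ := (e x).1 hx
        obtain ⟨σ, hσp, hσx, hσ⟩ := G.homogeneous p x w hxw
        refine (e w).2 ⟨σ v, ?_, ?_⟩
        · rw [hiff, ← hσp, hσ, ← hiff]; exact hv
        · rw [← hσx, hσ]; exact hvx
  obtain ⟨-, -, J, hJ, h0, hiff⟩ := key n
  have := G.isPreconnected_inter p w J (radius τ κ (n + 1)) hJ h0 (hG.radius_le _)
  simpa only [hiff, G.F_comm _ w] using this

/-- A timelike curve which is short with respect to a grid is homotopic to a polygon. -/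
lemma ChordGeometry.IsGrid.exists_polygon (hG : G.IsGrid a τ κ) {n : ℕ} {γ : ℝ → TimeAxis × N}
    (hγ : IsTimelikeOn (warpedMetric a h) (timeField d N) γ 0 1) (h0 : γ 0 = (τ 0, p))
    (h1 : (γ 1).1 = τ (n + 1))
    (hshort : ∀ i ≤ n, ∀ s ∈ Icc (0 : ℝ) 1, ∀ s' ∈ Icc (0 : ℝ) 1, s < s' → (τ i : ℝ) ≤ timeOf γ s →
      timeOf γ s' ≤ τ (i + 1) →
        G.F (γ s).2 (γ s').2 < (κ i * (timeOf γ s' - timeOf γ s)) ^ 2) :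
    ∃ β, G.IsPolygon τ κ p n (γ 1).2 β ∧
      IsHomotopic (warpedMetric a h) (timeField d N) γ β := by
  -- The part of the curve inside one slab is coned off; shortness is needed from its initial point
  -- to every later one.
  have cone : ∀ (i : ℕ) (δ : ℝ → TimeAxis × N),
      IsTimelikeOn (warpedMetric a h) (timeField d N) δ 0 1 → (δ 0).1 = τ i →
      (δ 1).1 = τ (i + 1) →
      (∀ s ∈ Icc (0 : ℝ) 1, ∀ s' ∈ Icc (0 : ℝ) 1, s < s' → (τ i : ℝ) ≤ timeOf δ s →
        timeOf δ s' ≤ τ (i + 1) →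
          G.F (δ s).2 (δ s').2 < (κ i * (timeOf δ s' - timeOf δ s)) ^ 2) →
      G.F (δ 0).2 (δ 1).2 < radius τ κ i ∧ IsHomotopic (warpedMetric a h) (timeField d N) δ
        (G.segment (τ i, (δ 0).2) (τ (i + 1), (δ 1).2)) := by
    intro i δ hδ e0 e1 hs
    have hmono := hδ.strictMonoOn_timeOf G
    have t0 : timeOf δ 0 = τ i := by rw [timeOf, e0]
    have t1 : timeOf δ 1 = τ (i + 1) := by rw [timeOf, e1]
    have hle : ∀ r ∈ Icc (0 : ℝ) 1, timeOf δ r ≤ τ (i + 1) := fun r hr =>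
      t1 ▸ hmono.monotoneOn hr (by simp) hr.2
    have hF : ∀ r ∈ Ioc (0 : ℝ) 1, _ := fun r hr =>
      hs 0 (by simp) r (Ioc_subset_Icc_self hr) hr.1 t0.ge (hle r (Ioc_subset_Icc_self hr))
    refine ⟨?_, ?_⟩
    · have := hF 1 (by simp)
      rwa [t0, t1] at this
    · have hh := G.isHomotopic_segment hδ fun r hr =>
        hG.step i (δ 0) (δ r) t0.ge (hmono (by simp) (Ioc_subset_Icc_self hr) hr.1)
          (hle r (Ioc_subset_Icc_self hr)) (hF r hr)
      rw [← e0, ← e1]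
      exact hh
  induction n generalizing γ with
  | zero =>
    obtain ⟨hF, hh⟩ := cone 0 γ hγ (by rw [h0]) h1 (hshort 0 le_rfl)
    rw [h0] at hF hh
    exact ⟨_, .base _ hF, hh⟩
  | succ n ih =>
    have hmono := hγ.strictMonoOn_timeOf G
    have hτ : StrictMono fun i => (τ i : ℝ) := strictMono_nat_of_lt_succ hG.lt_succ
    have t0 : timeOf γ 0 = τ 0 := by rw [timeOf, h0]
    have t1 : timeOf γ 1 = τ (n + 2) := by rw [timeOf, h1]
    have hct : ContinuousOn (timeOf γ) (Icc 0 1) :=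
      (continuous_subtype_val.comp continuous_fst).comp_continuousOn hγ.continuousOn
    have hmem : (τ (n + 1) : ℝ) ∈ Ioo (timeOf γ 0) (timeOf γ 1) := by
      rw [t0, t1]; exact ⟨hτ (by omega), hτ (by omega)⟩
    -- The curve is cut where it enters the last slab.
    obtain ⟨m, hm, htm⟩ := intermediate_value_Ioo zero_le_one hct hmem
    have hm1 : 0 < 1 - m := sub_pos.2 hm.2
    have hA : IsTimelikeOn (warpedMetric a h) (timeField d N) (fun s => γ (m * s)) 0 1 := by
      simpa using (hγ.left hm.1 hm.2.le).comp_affine (k := m) (c := 0) (a := 0) (b := 1) hm.1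
        (by simp) (by simp)
    have hB : IsTimelikeOn (warpedMetric a h) (timeField d N)
        (fun s => γ ((1 - m) * s + m)) 0 1 :=
      (hγ.right hm.1.le hm.2).comp_affine (k := 1 - m) (c := m) (a := 0) (b := 1) hm1
        (by simp) (by simp)
    have memA : ∀ s ∈ Icc (0 : ℝ) 1, m * s ∈ Icc (0 : ℝ) 1 := fun s hs =>
      ⟨mul_nonneg hm.1.le hs.1, mul_le_one₀ hm.2.le hs.1 hs.2⟩
    have memB : ∀ s ∈ Icc (0 : ℝ) 1, (1 - m) * s + m ∈ Icc (0 : ℝ) 1 := fun s hs =>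
      ⟨by have := mul_nonneg hm1.le hs.1; linarith [hm.1],
        by have := mul_nonneg hm1.le (sub_nonneg.2 hs.2); linarith⟩
    have hγm : (γ m).1 = τ (n + 1) := Subtype.ext htm
    obtain ⟨β, hβ, hhom⟩ := ih (γ := fun s => γ (m * s)) hA (by simpa using h0)
      (by simpa using hγm) fun i hi s hs s' hs' hss' =>
        hshort i (by omega) _ (memA s hs) _ (memA s' hs') (mul_lt_mul_of_pos_left hss' hm.1)
    obtain ⟨hF, hh⟩ := cone (n + 1) (fun s => γ ((1 - m) * s + m)) hB (by simpa using hγm)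
      (by simpa using h1) fun s hs s' hs' hss' =>
        hshort (n + 1) le_rfl _ (memB s hs) _ (memB s' hs')
          (by have := mul_lt_mul_of_pos_left hss' hm1; linarith)
    -- The two expressions for the cut point are unified, so that the polygon and the last segment
    -- match syntactically.
    have ev : ∀ f : ℝ → N, f (m * 1) = f ((1 - m) * 0 + m) := fun f => by congr 1; ring
    have ew : (1 - m) * 1 + m = 1 := by ring
    simp only [ev fun s => (γ s).2, ew] at hF hh hβ
    refine ⟨_, .step n _ _ β hβ hF, (hγ.isHomotopic_cut hm).trans (hhom.concat hh ?_)⟩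
    simp

end Polygons

/-! ### Choice of the grid, and the general theorem -/

section Grids

variable {d : ℕ} {N : Type*} [TopologicalSpace N] [ChartedSpace (EuclideanSpace ℝ (Fin d)) N]
  {a : ℝ → ℝ} {h : TensorField (𝓡 d) N}
  {V : Type*} [NormedAddCommGroup V] [NormedSpace ℝ V]

/-- A positive continuous function has small relative oscillation at small scale on compacta. -/
lemma exists_oscillation_le (ha : ContinuousOn a (Ioi 0)) (hpos : ∀ t, 0 < t → 0 < a t)
    {t₀ t₁ c : ℝ} (h0 : 0 < t₀) (h1 : t₀ ≤ t₁) (hc : 1 < c) :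
    ∃ m > 0, (∀ t ∈ Icc t₀ t₁, m ≤ a t) ∧ ∃ δ > 0, ∀ t ∈ Icc t₀ t₁, ∀ t' ∈ Icc t₀ t₁,
      |t - t'| < δ → a t ^ 2 ≤ c * a t' ^ 2 := by
  have hsub : Icc t₀ t₁ ⊆ Ioi (0 : ℝ) := fun t ht => h0.trans_le ht.1
  have hca := ha.mono hsub
  obtain ⟨x, hx, hmin⟩ := isCompact_Icc.exists_isMinOn (nonempty_Icc.2 h1) hca
  have hm := hpos x (hsub hx)
  refine ⟨a x, hm, fun t ht => hmin ht, ?_⟩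
  have hu := isCompact_Icc.uniformContinuousOn_of_continuous (hca.pow 2)
  -- With this tolerance, `a t ^ 2 ≤ a t' ^ 2 + (c - 1) * a x ^ 2 ≤ c * a t' ^ 2`, as `a x` is the
  -- minimum.
  obtain ⟨δ, hδ, H⟩ := Metric.uniformContinuousOn_iff.1 hu ((c - 1) * a x ^ 2)
    (mul_pos (sub_pos.2 hc) (pow_pos hm 2))
  refine ⟨δ, hδ, fun t ht t' ht' htt => ?_⟩
  have h2 := H t ht t' ht' htt
  rw [Real.dist_eq] at h2
  have h3 : a x ^ 2 ≤ a t' ^ 2 := pow_le_pow_left₀ hm.le (hmin ht') 2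
  have h4 := (abs_lt.1 h2).2
  simp only [Pi.pow_apply] at h4
  nlinarith [mul_le_mul_of_nonneg_left h3 (sub_pos.2 hc).le]

/-- The light cone of a slab is frozen at its lower time `τ i` and slightly narrowed, to `κ i = 1 /
(c * a (τ i))`. The narrowing makes segments timelike throughout the slab, and the gap `θ < 1` keeps
the curves inside the narrower cone. -/
lemma ChordGeometry.exists_grid (G : ChordGeometry h V) (ha : ContinuousOn a (Ioi 0))
    (hpos : ∀ t, 0 < t → 0 < a t) {t₀ t₁ : TimeAxis} (hlt : (t₀ : ℝ) < t₁) {θ : ℝ} (hθ : θ < 1) :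
    ∃ (n : ℕ) (τ : ℕ → TimeAxis) (κ : ℕ → ℝ), G.IsGrid a τ κ ∧ τ 0 = t₀ ∧ τ (n + 1) = t₁ ∧
      ∀ i ≤ n, ∀ (x : ℝ → N) (t : ℝ → ℝ) (α β : ℝ), α < β → ContinuousOn x (Icc α β) →
        StrictMonoOn t (Icc α β) → ContinuousOn t (Icc α β) →
        (∀ u ∈ Ico α β, ∃ (X' : V) (t' : ℝ), HasDerivWithinAt (fun s => G.ι (x s)) X' (Ici u) u ∧
          HasDerivWithinAt t t' (Ici u) u ∧ 0 < t' ∧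
          a (t u) ^ 2 * G.Q (G.ι (x u)) X' ≤ θ * t' ^ 2) →
        (τ i : ℝ) ≤ t α → t β ≤ τ (i + 1) → G.F (x α) (x β) < (κ i * (t β - t α)) ^ 2 := by
  -- Five factors `c`: one for the oscillation of `a`, four from the slope `κ' = 1 / (c ^ 2 * a (τ
  -- i))`, squared. The slope `κ'` leaves room for the loss `c` in `F_le`.
  obtain ⟨c, hc, hcθ⟩ : ∃ c : ℝ, 1 < c ∧ c ^ 5 * θ < 1 := by
    have h1 : ContinuousAt (fun c : ℝ => c ^ 5 * θ) 1 := by fun_prop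
    have h2 : ∀ᶠ c in 𝓝[>] (1 : ℝ), c ^ 5 * θ < 1 :=
      (h1.eventually_lt_const (by simpa using hθ)).filter_mono nhdsWithin_le_nhds
    obtain ⟨c, h3, h4⟩ := (h2.and self_mem_nhdsWithin).exists
    exact ⟨c, h4, h3⟩
  have hc0 : 0 < c := one_pos.trans hc
  obtain ⟨ε₁, hε₁, hspeed⟩ := G.seg_speed c hc
  obtain ⟨ε₂, hε₂, hlen⟩ := G.F_le c hc
  have ht0 : (0 : ℝ) < t₀ := t₀.2
  obtain ⟨m, hm, ham, δ, hδ, hosc⟩ := exists_oscillation_le ha hpos ht0 hlt.le hc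
  -- The bound by `1` gives `η ^ 2 ≤ η`, as the thresholds `ε₁` and `G.ε₀` concern squared lengths.
  set η : ℝ := min 1 (min ε₂ (min ε₁ G.ε₀)) with hη
  have hη0 : 0 < η := by simp [hη, hε₁, hε₂, G.ε₀_pos]
  have hη1 : η ≤ 1 := min_le_left _ _
  have hηε : η ^ 2 ≤ min ε₁ G.ε₀ := by
    have : η ≤ min ε₁ G.ε₀ := (min_le_right _ _).trans (min_le_right _ _)
    nlinarith
  have hη2 : η ≤ ε₂ := (min_le_right _ _).trans (min_le_left _ _)
  obtain ⟨n, hn⟩ := exists_nat_gt (((t₁ : ℝ) - t₀) / min δ (m * η))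
  have hmin : 0 < min δ (m * η) := lt_min hδ (mul_pos hm hη0)
  set Δ : ℝ := ((t₁ : ℝ) - t₀) / (n + 1) with hΔ
  have hn1 : (0 : ℝ) < n + 1 := by positivity
  have hΔ0 : 0 < Δ := div_pos (sub_pos.2 hlt) hn1
  have hΔmin : Δ < min δ (m * η) := by
    rw [hΔ, div_lt_iff₀ hn1]
    rw [div_lt_iff₀ hmin] at hn
    nlinarith
  have hΔδ : Δ < δ := hΔmin.trans_le (min_le_left _ _)
  have hΔη : Δ < m * η := hΔmin.trans_le (min_le_right _ _)
  have hΔn : (t₀ : ℝ) + (n + 1) * Δ = t₁ := by rw [hΔ]; field_simp; ring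
  set τ : ℕ → TimeAxis := fun i => ⟨t₀ + i * Δ, mem_Ioi.2 (by positivity)⟩ with hτ
  have hτi : ∀ i, (τ i : ℝ) = t₀ + i * Δ := fun i => rfl
  have hτs : ∀ i, (τ (i + 1) : ℝ) - τ i = Δ := fun i => by rw [hτi, hτi]; push_cast; ring
  have hτ0 : ∀ i, (t₀ : ℝ) ≤ τ i := fun i => by
    rw [hτi]
    exact le_add_of_nonneg_right (by positivity)
  have hτ1 : ∀ i ≤ n, (τ (i + 1) : ℝ) ≤ t₁ := fun i hi => by
    rw [hτi, ← hΔn]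
    have : ((i + 1 : ℕ) : ℝ) ≤ n + 1 := by exact_mod_cast Nat.succ_le_succ hi
    nlinarith
  -- A grid is infinite, while the control on `a` covers only `[t₀, t₁]`. In the slabs past `t₁`,
  -- which no curve enters, any sufficiently small slope will do.
  have hκ : ∀ i, ∃ κ : ℝ, 0 < κ ∧ (κ * Δ) ^ 2 ≤ min ε₁ G.ε₀ ∧
      (∀ t ∈ Icc (τ i : ℝ) (τ (i + 1)), a t ^ 2 * c * κ ^ 2 ≤ 1) ∧
      (i ≤ n → κ = (c * a (τ i))⁻¹) := by
    intro i
    by_cases hi : i ≤ n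
    · have hmem : (τ i : ℝ) ∈ Icc (t₀ : ℝ) t₁ :=
        ⟨hτ0 i, (by linarith [hτs i] : (τ i : ℝ) ≤ τ (i + 1)).trans (hτ1 i hi)⟩
      have hai : 0 < a (τ i) := hpos _ (τ i).2
      refine ⟨(c * a (τ i))⁻¹, by positivity, ?_, fun t ht => ?_, fun _ => rfl⟩
      · refine le_trans (pow_le_pow_left₀ (by positivity) ?_ 2) hηε
        rw [inv_mul_le_iff₀ (by positivity)]
        have := ham _ hmem
        have h1 : m * η ≤ a (τ i) * η := mul_le_mul_of_nonneg_right this hη0.le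
        have h2 : a (τ i) * η ≤ c * a (τ i) * η := by
          nlinarith [mul_pos hai hη0]
        linarith
      · have ht' : t ∈ Icc (t₀ : ℝ) t₁ := ⟨(hτ0 i).trans ht.1, ht.2.trans (hτ1 i hi)⟩
        have habs : |t - τ i| < δ := by
          rw [abs_of_nonneg (sub_nonneg.2 ht.1)]
          linarith [ht.2, hτs i]
        have h1 := hosc t ht' _ hmem habs
        have h2 : 0 < c ^ 2 * a (τ i) ^ 2 := by positivity
        rw [inv_pow, mul_pow, ← div_eq_mul_inv, div_le_one h2]
        nlinarith
    · have hsub : Icc (τ i : ℝ) (τ (i + 1)) ⊆ Ioi 0 := fun t ht => (τ i).2.trans_le ht.1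
      obtain ⟨A, hA⟩ := isCompact_Icc.bddAbove_image (((ha.mono hsub).pow 2).mul_const c)
      have hlim : Tendsto (fun κ : ℝ => max A 0 * κ ^ 2) (𝓝[>] 0) (𝓝 0) :=
        (Continuous.tendsto' (by fun_prop) _ _ (by simp)).mono_left nhdsWithin_le_nhds
      have hlim' : Tendsto (fun κ : ℝ => (κ * Δ) ^ 2) (𝓝[>] 0) (𝓝 0) :=
        (Continuous.tendsto' (by fun_prop) _ _ (by simp)).mono_left nhdsWithin_le_nhds
      obtain ⟨κ, ⟨h1, h2⟩, h3⟩ := (((hlim.eventually_lt_const one_pos).and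
        (hlim'.eventually_lt_const (lt_min hε₁ G.ε₀_pos))).and self_mem_nhdsWithin).exists
      refine ⟨κ, h3, h2.le, fun t ht => ?_, fun h => absurd h hi⟩
      have h4 : a t ^ 2 * c ≤ A := hA ⟨t, ht, rfl⟩
      exact (mul_le_mul_of_nonneg_right (h4.trans (le_max_left A 0)) (sq_nonneg _)).trans h1.le
  choose κ hκ0 hκΔ hκa hκn using hκ
  refine ⟨n, τ, κ, ⟨fun i => by linarith [hτs i], hκ0, fun i => ?_, ?_⟩, ?_, ?_, ?_⟩
  · rw [hτs]; exact (hκΔ i).trans (min_le_right _ _)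
  · intro i P P' h1 h2 h3 hF
    have hle : (κ i * ((P'.1 : ℝ) - P.1)) ^ 2 ≤ (κ i * Δ) ^ 2 := by
      have := hκ0 i
      have h4 : (P'.1 : ℝ) - P.1 ≤ Δ := by linarith [hτs i]
      have h5 : 0 ≤ (P'.1 : ℝ) - P.1 := by linarith
      gcongr
    have hF' := hF.trans_le (hle.trans (hκΔ i))
    have hF0 := hF'.trans_le (min_le_right _ _)
    refine ⟨hF0, G.isTimelikeOn_segment hF0 h2
      (hspeed _ _ (hF'.trans_le (min_le_left _ _)) hF0) fun t ht => ?_⟩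
    have ht' : t ∈ Icc (τ i : ℝ) (τ (i + 1)) := ⟨h1.trans ht.1, ht.2.trans h3⟩
    have hat : 0 < a t := hpos t ((τ i).2.trans_le ht'.1)
    calc a t ^ 2 * (c * G.F P.2 P'.2) < a t ^ 2 * (c * (κ i * ((P'.1 : ℝ) - P.1)) ^ 2) := by gcongr
      _ = (a t ^ 2 * c * κ i ^ 2) * ((P'.1 : ℝ) - P.1) ^ 2 := by ring
      _ ≤ 1 * ((P'.1 : ℝ) - P.1) ^ 2 := mul_le_mul_of_nonneg_right (hκa i t ht') (sq_nonneg _)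
      _ = _ := one_mul _
  · exact Subtype.ext (by simp [hτ])
  · exact Subtype.ext (by rw [hτi]; push_cast; exact hΔn)
  · intro i hi x t α β hαβ hx hmono ht hder h1 h2
    have hai : 0 < a (τ i) := hpos _ (τ i).2
    have hmem : (τ i : ℝ) ∈ Icc (t₀ : ℝ) t₁ :=
      ⟨hτ0 i, (by linarith [hτs i] : (τ i : ℝ) ≤ τ (i + 1)).trans (hτ1 i hi)⟩
    have htt : t α < t β := hmono (left_mem_Icc.2 hαβ.le) (right_mem_Icc.2 hαβ.le) hαβ
    -- The curve has speed below `κ'` with respect to `t`, so its squared chord is at most `c * κ' ^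
    -- 2`, that is `c⁻³ * a (τ i)⁻²`, times the squared time difference. This is below the allowed
    -- `c⁻² * a (τ i)⁻²`.
    set κ' : ℝ := (c ^ 2 * a (τ i))⁻¹ with hκ'
    have hκ'0 : 0 < κ' := by positivity
    have hQ : ∀ u ∈ Ico α β, ∃ (X' : V) (t' : ℝ),
        HasDerivWithinAt (fun s => G.ι (x s)) X' (Ici u) u ∧
        HasDerivWithinAt t t' (Ici u) u ∧ 0 < t' ∧ G.Q (G.ι (x u)) X' < κ' ^ 2 * t' ^ 2 := by
      intro u hu
      obtain ⟨X', t', hX, ht', ht0', hQ⟩ := hder u hu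
      refine ⟨X', t', hX, ht', ht0', ?_⟩
      -- `Q` is not assumed nonnegative in the ambient space, and the chain of estimates multiplies
      -- by it.
      rcases le_or_gt (G.Q (G.ι (x u)) X') 0 with hneg | hposQ
      · exact hneg.trans_lt (by positivity)
      have hu' := Ico_subset_Icc_self hu
      have hl : t α ≤ t u := hmono.monotoneOn (left_mem_Icc.2 hαβ.le) hu' hu.1
      have hr : t u ≤ t β := hmono.monotoneOn hu' (right_mem_Icc.2 hαβ.le) hu.2.le
      have hmem' : t u ∈ Icc (t₀ : ℝ) t₁ :=
        ⟨(hτ0 i).trans (h1.trans hl), (hr.trans h2).trans (hτ1 i hi)⟩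
      have habs : |(τ i : ℝ) - t u| < δ := by
        rw [abs_sub_comm, abs_of_nonneg (by linarith)]
        linarith [hτs i]
      have h3 := hosc _ hmem _ hmem' habs
      have h4 : c ^ 4 * a (τ i) ^ 2 * G.Q (G.ι (x u)) X' < t' ^ 2 := by
        calc c ^ 4 * a (τ i) ^ 2 * G.Q (G.ι (x u)) X'
            ≤ c ^ 4 * (c * a (t u) ^ 2) * G.Q (G.ι (x u)) X' := by gcongr
          _ = c ^ 5 * (a (t u) ^ 2 * G.Q (G.ι (x u)) X') := by ring
          _ ≤ c ^ 5 * (θ * t' ^ 2) := by gcongr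
          _ = c ^ 5 * θ * t' ^ 2 := by ring
          _ < 1 * t' ^ 2 := by gcongr
          _ = t' ^ 2 := one_mul _
      rw [hκ', inv_pow, inv_mul_eq_div, lt_div_iff₀ (by positivity)]
      calc _ = c ^ 4 * a (τ i) ^ 2 * G.Q (G.ι (x u)) X' := by ring
        _ < _ := h4
    have hc2 : 1 < c ^ 2 := one_lt_pow₀ hc two_ne_zero
    have hsmall : κ' * (t β - t α) < ε₂ := by
      have h3 : t β - t α ≤ Δ := by linarith [hτs i]
      have h4 := ham _ hmem
      rw [hκ', inv_mul_lt_iff₀ (by positivity)]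
      calc t β - t α ≤ Δ := h3
        _ < m * η := hΔη
        _ ≤ a (τ i) * ε₂ := by gcongr
        _ ≤ c ^ 2 * a (τ i) * ε₂ := by
            rw [mul_assoc]; exact le_mul_of_one_le_left (by positivity) hc2.le
    refine (hlen κ' x t α β hκ'0 hαβ.le hx ht hQ hsmall).trans_lt ?_
    rw [hκn i hi]
    have hpos2 : 0 < (t β - t α) ^ 2 := pow_pos (sub_pos.2 htt) 2
    rw [mul_pow, mul_pow, ← mul_assoc]
    refine mul_lt_mul_of_pos_right ?_ hpos2
    rw [hκ', inv_pow, inv_pow, ← div_eq_mul_inv, div_lt_iff₀ (by positivity),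
      inv_mul_eq_div, lt_div_iff₀ (by positivity)]
    have : c ^ 3 < c ^ 4 := pow_lt_pow_right₀ hc (by norm_num)
    nlinarith [pow_pos hai 2]

theorem ChordGeometry.warpedFutureOneConnected [LocallyPathConnectedSpace N]
    (G : ChordGeometry h V) (ha : IsScaleFactor a) : WarpedFutureOneConnected a h := by
  intro p q γ₀ γ₁ ⟨h₀, e₀, f₀⟩ ⟨h₁, e₁, f₁⟩
  rw [isFutureTimelikeCurve_iff] at h₀ h₁
  have hca := ha.contDiffOn.continuousOn
  obtain ⟨θ₀, hθ₀, H₀⟩ := h₀.exists_uniform G hca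
  obtain ⟨θ₁, hθ₁, H₁⟩ := h₁.exists_uniform G hca
  have hlt : (p.1 : ℝ) < q.1 := by
    have := h₀.strictMonoOn_timeOf G (left_mem_Icc.2 zero_le_one) (right_mem_Icc.2 zero_le_one)
      one_pos
    rwa [timeOf, timeOf, e₀, f₀] at this
  -- The larger of the two gap factors gives one grid for both curves, so that their polygons are
  -- comparable.
  obtain ⟨n, τ, κ, hG, τ0, τ1, hshort⟩ := G.exists_grid hca ha.pos hlt (max_lt hθ₀ hθ₁)
  have main : ∀ (γ : ℝ → TimeAxis × N), IsTimelikeOn (warpedMetric a h) (timeField d N) γ 0 1 →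
      γ 0 = p → γ 1 = q → (∃ θ ≤ max θ₀ θ₁, ∀ u ∈ Ico (0 : ℝ) 1, ∃ (X' : V) (t' : ℝ),
        HasDerivWithinAt (G.pos γ) X' (Ici u) u ∧ HasDerivWithinAt (timeOf γ) t' (Ici u) u ∧
        0 < t' ∧ a (timeOf γ u) ^ 2 * G.Q (G.pos γ u) X' ≤ θ * t' ^ 2) →
      ∃ β, G.IsPolygon τ κ p.2 n q.2 β ∧
        IsHomotopic (warpedMetric a h) (timeField d N) γ β := by
    rintro γ hγ e f ⟨θ, hθ, H⟩
    have hp : γ 0 = (τ 0, p.2) := by rw [e, τ0]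
    have hq : (γ 1).1 = τ (n + 1) := by rw [f, τ1]
    rw [← f]
    refine hG.exists_polygon hγ hp hq fun i hi s hs s' hs' hss' k1 k2 => ?_
    have hsub : Icc s s' ⊆ Icc 0 1 := Icc_subset_Icc hs.1 hs'.2
    have hc := hγ.continuousOn.mono hsub
    refine hshort i hi (fun u => (γ u).2) (timeOf γ) s s' hss' (continuous_snd.comp_continuousOn hc)
      ((hγ.strictMonoOn_timeOf G).mono hsub)
      ((continuous_subtype_val.comp continuous_fst).comp_continuousOn hc) (fun u hu => ?_) k1 k2
    obtain ⟨X', t', h1, h2, h3, h4⟩ := H u ⟨hs.1.trans hu.1, hu.2.trans_le hs'.2⟩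
    exact ⟨X', t', h1, h2, h3, h4.trans (mul_le_mul_of_nonneg_right hθ (sq_nonneg _))⟩
  obtain ⟨β₀, hβ₀, k₀⟩ := main γ₀ h₀ e₀ f₀ ⟨θ₀, le_max_left _ _, H₀⟩
  obtain ⟨β₁, hβ₁, k₁⟩ := main γ₁ h₁ e₁ f₁ ⟨θ₁, le_max_right _ _, H₁⟩
  obtain ⟨Γ, hΓ, hend, hΓ0, hΓ1⟩ :=
    (k₀.trans (hβ₀.isHomotopic hG hG.isPreconnected_reachable hβ₁)).trans k₁.symm
  exact ⟨Γ, hΓ.1, fun r hr => ⟨isFutureTimelikeCurve_iff.2 (hΓ.2 r hr), (hend r hr).1,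
    (hend r hr).2⟩, hΓ0, hΓ1⟩

end Grids

/-! ### Convexity and speed estimates; Euclidean space -/

section Euclidean

variable {E : Type*} [NormedAddCommGroup E] [InnerProductSpace ℝ E]

/-- The set is convex: along a segment `F p` lies between `0` and the larger of its end values, both
of which belong to `J`. -/
lemma isPreconnected_inter_of_convexOn {F : E → E → ℝ} (hF : ∀ p, ConvexOn ℝ univ (F p))
    (h0 : ∀ p x, 0 ≤ F p x) (p q : E) {J : Set ℝ} (c : ℝ) (hJ : J.OrdConnected) (hJ0 : 0 ∈ J) :
    IsPreconnected {x | F p x ∈ J ∧ F q x < c} := by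
  refine Convex.isPreconnected ?_
  refine convex_iff_segment_subset.2 fun x hx y hy z hz => ⟨?_, ?_⟩
  · have hm : max (F p x) (F p y) ∈ J := by
      rcases max_choice (F p x) (F p y) with h | h <;> rw [h]
      exacts [hx.1, hy.1]
    exact hJ.out hJ0 hm ⟨h0 p z, (hF p).le_on_segment (mem_univ x) (mem_univ y) hz⟩
  · exact ((hF q).le_on_segment (mem_univ x) (mem_univ y) hz).trans_lt (max_lt hx.2 hy.2)

lemma le_of_hasDerivWithinAt_pos {t t' : ℝ → ℝ} {α β : ℝ} (ht : ContinuousOn t (Icc α β))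
    (hd : ∀ u ∈ Ico α β, HasDerivWithinAt t (t' u) (Ici u) u) (hpos : ∀ u ∈ Ico α β, 0 < t' u) :
    ∀ u ∈ Icc α β, t α ≤ t u := fun _ hu =>
  image_le_of_deriv_right_lt_deriv_boundary' (f := fun _ => t α) (f' := fun _ => 0)
    continuousOn_const (fun _ _ => hasDerivWithinAt_const _ _ _) le_rfl ht hd
    (fun x hx _ => hpos x hx) hu

/-- Mean value inequality with `κ * t` as the comparison function; right derivatives suffice. -/
lemma norm_sub_le_of_speed {V : Type*} [NormedAddCommGroup V] [NormedSpace ℝ V] {κ α β : ℝ}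
    {X : ℝ → V} {t : ℝ → ℝ} (hκ : 0 < κ) (hαβ : α ≤ β) (hX : ContinuousOn X (Icc α β))
    (ht : ContinuousOn t (Icc α β))
    (hd : ∀ u ∈ Ico α β, ∃ (X' : V) (t' : ℝ), HasDerivWithinAt X X' (Ici u) u ∧
      HasDerivWithinAt t t' (Ici u) u ∧ 0 < t' ∧ ‖X'‖ ^ 2 < κ ^ 2 * t' ^ 2) :
    ‖X β - X α‖ ≤ κ * (t β - t α) := by
  choose! X' t' h1 h2 h3 h4 using hd
  refine image_norm_le_of_norm_deriv_right_le_deriv_boundary' (f := fun u => X u - X α) (f' := X')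
    (B := fun u => κ * (t u - t α)) (B' := fun u => κ * t' u) (hX.sub continuousOn_const)
    (fun u hu => (h1 u hu).sub_const _) (by simp) (continuousOn_const.mul (ht.sub continuousOn_const))
    (fun u hu => ((h2 u hu).sub_const _).const_mul κ) (fun u hu => ?_) (right_mem_Icc.2 hαβ)
  have := h3 u hu
  refine (abs_le_of_sq_le_sq' ?_ (by positivity)).2
  rw [mul_pow]; exact (h4 u hu).le

/-- The reflection fixing `p` and exchanging two points at the same distance from `p`. -/
lemma exists_isometry_of_norm_eq {p x y : E} (h : ‖x - p‖ = ‖y - p‖) :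
    ∃ σ : E → E, σ p = p ∧ σ x = y ∧ ∀ z w, ‖σ w - σ z‖ = ‖w - z‖ := by
  refine ⟨fun z => p + (ℝ ∙ ((x - p) - (y - p)))ᗮ.reflection (z - p), by simp, ?_, fun z w => ?_⟩
  · simp only [Submodule.reflection_sub h]; abel
  · rw [add_sub_add_left_eq_sub, ← map_sub, LinearIsometryEquiv.norm_map]
    congr 1; abel

end Euclidean

/-- Euclidean space, with straight segments. -/
def euclideanGeometry (d : ℕ) :
    ChordGeometry (euclideanMetric d) (EuclideanSpace ℝ (Fin d)) where
  ι := id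
  Q _ v := ‖v‖ ^ 2
  F x y := ‖y - x‖ ^ 2
  seg u v s := (1 - s) • u + s • v
  ε₀ := 1
  contMDiff_ι := contMDiff_id
  metric_eq p v := by
    rw [mfderiv_id]
    exact real_inner_self_eq_norm_sq (F := EuclideanSpace ℝ (Fin d)) v
  continuous_Q := by fun_prop
  continuous_F := by fun_prop
  F_self x := by simp
  F_comm x y := by rw [norm_sub_rev]
  ε₀_pos := one_pos
  seg_zero u v _ := by simp
  seg_one u v _ := by simp
  seg_self u s _ := by rw [← add_smul]; simp
  continuousOn_seg := Continuous.continuousOn (by fun_prop)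
  contMDiffOn_seg u v _ := (ContDiff.contMDiff (by fun_prop)).contMDiffOn
  seg_speed c hc := by
    refine ⟨1, one_pos, fun u v _ _ s hs => ?_⟩
    have h1 : HasDerivAt (fun s : ℝ => id ((1 - s) • u + s • v)) (v - u) s := by
      refine ((((hasDerivAt_id' s).const_sub 1).smul_const u).add
        ((hasDerivAt_id' s).smul_const v)).congr_deriv ?_
      rw [neg_one_smul, one_smul]; abel
    rw [h1.hasDerivWithinAt.derivWithin (uniqueDiffOn_Icc one_pos s hs)]
    exact le_mul_of_one_le_left (by positivity) hc.le
  F_le c hc := by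
    refine ⟨1, one_pos, fun κ x t α β hκ hαβ hx ht hd _ => ?_⟩
    have h1 := norm_sub_le_of_speed hκ hαβ hx ht hd
    calc ‖x β - x α‖ ^ 2 ≤ (κ * (t β - t α)) ^ 2 := by gcongr
      _ ≤ _ := le_mul_of_one_le_left (by positivity) hc.le
  homogeneous p x y h := by
    obtain ⟨σ, h1, h2, h3⟩ := exists_isometry_of_norm_eq (p := p) (x := x) (y := y)
      ((pow_left_inj₀ (norm_nonneg _) (norm_nonneg _) two_ne_zero).1 h)
    exact ⟨σ, h1, h2, fun z w => by rw [h3]⟩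
  isPreconnected_inter p q J c hJ h0 _ := by
    refine isPreconnected_inter_of_convexOn
      (F := fun x y : EuclideanSpace ℝ (Fin d) => ‖y - x‖ ^ 2) (fun p => ?_)
      (fun _ _ => by positivity) p q c hJ h0
    have := (convexOn_dist p (convex_univ (𝕜 := ℝ) (E := EuclideanSpace ℝ (Fin d)))).pow
      (fun _ _ => dist_nonneg) 2
    simp only [dist_eq_norm] at this
    exact this

/-! ### Hyperbolic space in the hyperboloid model -/

section Height

variable {E : Type*} [NormedAddCommGroup E]

/-- The height `√(1 + |x|²)` over `x` of the upper sheet of the hyperboloid. -/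
def height (x : E) : ℝ := √(1 + ‖x‖ ^ 2)

lemma height_pos (x : E) : 0 < height x := Real.sqrt_pos.2 (by positivity)

lemma height_sq (x : E) : height x ^ 2 = 1 + ‖x‖ ^ 2 := Real.sq_sqrt (by positivity)

lemma height_eq {x : E} {s : ℝ} (hs : 0 ≤ s) (h : s ^ 2 = 1 + ‖x‖ ^ 2) : height x = s := by
  rw [height, ← h, Real.sqrt_sq hs]

@[fun_prop]
lemma continuous_height : Continuous (height : E → ℝ) := by unfold height; fun_prop

end Height

section Hyperbolic

variable {E : Type*} [NormedAddCommGroup E] [InnerProductSpace ℝ E]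

/-- The squared Minkowski length of the chord between two points of the hyperboloid; it equals
`2 (cosh dist - 1)`. -/
def hypChord (x y : E) : ℝ := 2 * (height x * height y - inner ℝ x y - 1)

/-- The hyperbolic metric as a quadratic form. -/
def hypForm (x v : E) : ℝ := ‖v‖ ^ 2 - (1 + ‖x‖ ^ 2)⁻¹ * inner ℝ x v ^ 2

lemma abs_inner_sq_le (x y : E) : inner ℝ x y ^ 2 ≤ ‖x‖ ^ 2 * ‖y‖ ^ 2 := by
  rw [← mul_pow]
  exact sq_le_sq' (by have := neg_le_of_abs_le (abs_real_inner_le_norm x y); linarith)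
    (real_inner_le_norm x y)

/-- Reverse Cauchy-Schwarz for future unit timelike vectors: the squares differ by `‖x - y‖ ^ 2`
plus the Cauchy-Schwarz defect of `x` and `y`. -/
lemma one_add_inner_le (x y : E) : 1 + inner ℝ x y ≤ height x * height y := by
  have h0 := mul_pos (height_pos x) (height_pos y)
  refine (abs_le_of_sq_le_sq' ?_ h0.le).2
  rw [mul_pow, height_sq, height_sq]
  have h1 := abs_inner_sq_le x y
  have h2 : 0 ≤ ‖x - y‖ ^ 2 := by positivity
  rw [norm_sub_sq_real] at h2
  nlinarith

lemma hypChord_nonneg (x y : E) : 0 ≤ hypChord x y := by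
  have := one_add_inner_le x y
  unfold hypChord; linarith

lemma hypChord_self (x : E) : hypChord x x = 0 := by
  unfold hypChord
  rw [real_inner_self_eq_norm_sq, ← sq, height_sq]; ring

lemma hypChord_comm (x y : E) : hypChord x y = hypChord y x := by
  unfold hypChord
  rw [real_inner_comm, mul_comm (height x)]

lemma hypChord_eq (x y : E) : hypChord x y = ‖y - x‖ ^ 2 - (height y - height x) ^ 2 := by
  unfold hypChord
  rw [norm_sub_sq_real, real_inner_comm]
  linear_combination height_sq x + height_sq y

lemma eq_of_hypChord_eq_zero {x y : E} (h : hypChord x y = 0) : x = y := by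
  have h1 : height x * height y = 1 + inner ℝ x y := by unfold hypChord at h; linarith
  have h2 : (1 + ‖x‖ ^ 2) * (1 + ‖y‖ ^ 2) = (1 + inner ℝ x y) ^ 2 := by
    rw [← h1, mul_pow, height_sq, height_sq]
  have h3 := abs_inner_sq_le x y
  have h4 : ‖x - y‖ ^ 2 ≤ 0 := by rw [norm_sub_sq_real]; nlinarith
  have h5 : ‖x - y‖ = 0 := by nlinarith [norm_nonneg (x - y)]
  exact sub_eq_zero.1 (norm_eq_zero.1 h5)

/-- A positive multiple of `height`, which is convex as the norm of `(1, x)`, plus an affine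
function. So hyperbolic balls are convex sets in these coordinates. -/
lemma convexOn_hypChord (p : E) : ConvexOn ℝ univ (hypChord p) := by
  have hh : ConvexOn ℝ univ (height : E → ℝ) := by
    refine ⟨convex_univ, fun x _ y _ α β hα hβ hαβ => ?_⟩
    have hx := height_pos x
    have hy := height_pos y
    simp only [smul_eq_mul]
    refine Real.sqrt_le_iff.2 ⟨by positivity, ?_⟩
    have h1 := mul_le_mul_of_nonneg_left (one_add_inner_le x y) (mul_nonneg hα hβ)
    have h2 : ‖α • x + β • y‖ ^ 2 =
        α ^ 2 * ‖x‖ ^ 2 + 2 * (α * β * inner ℝ x y) + β ^ 2 * ‖y‖ ^ 2 := by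
      rw [norm_add_sq_real, real_inner_smul_left, real_inner_smul_right, norm_smul, norm_smul,
        mul_pow, mul_pow, Real.norm_eq_abs, Real.norm_eq_abs, sq_abs, sq_abs]
      ring
    have h3 : (α + β) ^ 2 = 1 := by rw [hαβ, one_pow]
    have h4 : (α * height x + β * height y) ^ 2 = α ^ 2 * (1 + ‖x‖ ^ 2) +
        2 * (α * β * (height x * height y)) + β ^ 2 * (1 + ‖y‖ ^ 2) := by
      rw [← height_sq, ← height_sq]; ring
    rw [h2, h4]
    nlinarith
  refine ⟨convex_univ, fun x hx y hy α β hα hβ hαβ => ?_⟩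
  have h1 := mul_le_mul_of_nonneg_left (hh.2 hx hy hα hβ hαβ) (height_pos p).le
  unfold hypChord
  simp only [smul_eq_mul, inner_add_right, real_inner_smul_right] at h1 ⊢
  have h2 : β = 1 - α := by linarith
  subst h2
  nlinarith

/-- Reflections of Minkowski space act transitively on the points of the hyperboloid at a given
distance from `p`. -/
lemma hypChord_homogeneous {p x y : E} (h : hypChord p x = hypChord p y) :
    ∃ σ : E → E, σ p = p ∧ σ x = y ∧ ∀ z w, hypChord (σ z) (σ w) = hypChord z w := by
  by_cases hD : hypChord y x = 0
  · exact ⟨id, rfl, (eq_of_hypChord_eq_zero hD).symm, fun _ _ => rfl⟩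
  set D := hypChord y x with hDdef
  set w := x - y with hw
  set w₀ := height x - height y with hw₀
  have hDeq : ‖w‖ ^ 2 - w₀ ^ 2 = D := (hypChord_eq y x).symm
  have hwp : inner ℝ p w = height p * w₀ := by
    unfold hypChord at h
    rw [hw, hw₀, inner_sub_right]; linarith
  -- The coefficient of the Minkowski reflection in the spacelike vector `(w₀, w)` from `y` to `x`,
  -- of squared length `D`. It fixes `p` because `p` is at equal chord from `x` and `y`.
  set μ : E → ℝ := fun z => 2 * (inner ℝ z w - height z * w₀) / D with hμ
  have hμD : ∀ z, μ z * D = 2 * (inner ℝ z w - height z * w₀) := fun z => div_mul_cancel₀ _ hD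
  clear_value D w w₀ μ
  set σ : E → E := fun z => z - μ z • w with hσ
  have hinner : ∀ z z', inner ℝ (σ z) (σ z') = inner ℝ z z' - μ z' * inner ℝ z w -
      μ z * inner ℝ z' w + μ z * μ z' * ‖w‖ ^ 2 := fun z z' => by
    simp only [hσ, inner_sub_left, inner_sub_right, real_inner_smul_left, real_inner_smul_right,
      real_inner_self_eq_norm_sq]
    rw [real_inner_comm z' w]; ring
  have hheight : ∀ z, height (σ z) = height z - μ z * w₀ := by
    intro z
    set s := height z - μ z * w₀ with hs
    have hs2 : s ^ 2 = 1 + ‖σ z‖ ^ 2 := by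
      rw [← real_inner_self_eq_norm_sq, hinner, real_inner_self_eq_norm_sq, hs]
      linear_combination height_sq z - μ z * hμD z - μ z ^ 2 * hDeq
    refine height_eq ?_ hs2
    -- The reflected point lies on the two-sheeted hyperboloid. It is on the upper sheet because its
    -- Minkowski product with `p` is preserved, and on the lower sheet that product would have the
    -- wrong sign.
    by_contra hneg
    push Not at hneg
    have h1 : inner ℝ (σ z) p = inner ℝ z p - μ z * (height p * w₀) := by
      rw [hσ, inner_sub_left, real_inner_smul_left, real_inner_comm p w, hwp]
    have h2 := one_add_inner_le z p
    have hp := height_pos p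
    have h3 : s * height p - inner ℝ (σ z) p ≥ 1 := by rw [h1, hs]; linarith
    have h4 : 0 < -s * height p := mul_pos (neg_pos.2 hneg) hp
    have h5 : (-s * height p) ^ 2 < inner ℝ (σ z) p ^ 2 := by nlinarith
    have h6 := abs_inner_sq_le (σ z) p
    rw [mul_pow, neg_sq, hs2, height_sq] at h5
    nlinarith [sq_nonneg ‖σ z‖, sq_nonneg ‖p‖]
  refine ⟨σ, ?_, ?_, fun z z' => ?_⟩
  · have : μ p = 0 := by simp [hμ, hwp]
    simp [hσ, this]
  · have : μ x = 1 := by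
      have e : 2 * (inner ℝ x w - height x * w₀) = D := by
        rw [hDdef, hw, hw₀, inner_sub_right, real_inner_self_eq_norm_sq, real_inner_comm]
        unfold hypChord
        linear_combination (-2) * height_sq x
      rw [hμ]; simp only [e]; exact div_self hD
    simp [hσ, this, hw]
  · unfold hypChord
    rw [hheight, hheight, hinner]
    linear_combination (-2) * μ z * μ z' * hDeq - μ z' * hμD z - μ z * hμD z'

lemma hypForm_nonneg (x v : E) : 0 ≤ hypForm x v := by
  have h1 := abs_inner_sq_le x v
  have h2 : 0 < 1 + ‖x‖ ^ 2 := by positivity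
  rw [hypForm, sub_nonneg, inv_mul_le_iff₀ h2]
  nlinarith [sq_nonneg ‖v‖]

/-- The derivative of `cosh (dist p x)` is bounded by the hyperbolic speed. -/
lemma sq_deriv_cosh_dist_le (p x v : E) :
    (height p * ((height x)⁻¹ * inner ℝ x v) - inner ℝ p v) ^ 2 ≤
      ((height p * height x - inner ℝ p x) ^ 2 - 1) * hypForm x v := by
  set B : LinearMap.BilinForm ℝ E := innerₗ E - (1 + ‖x‖ ^ 2)⁻¹ •
      LinearMap.BilinForm.linMulLin (innerₗ E x) (innerₗ E x) with hB
  have hBv : ∀ v w, B v w = inner ℝ v w - (1 + ‖x‖ ^ 2)⁻¹ * (inner ℝ x v * inner ℝ x w) :=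
    fun v w => rfl
  have hBq : ∀ v, B v v = hypForm x v := fun v => by
    rw [hBv, hypForm, real_inner_self_eq_norm_sq, ← sq]
  set c := height p * height x - inner ℝ p x with hc
  have hx := (height_pos x).ne'
  have e0 : (1 + ‖x‖ ^ 2)⁻¹ = (height x)⁻¹ ^ 2 := by rw [← height_sq, inv_pow]
  have en : ‖x‖ ^ 2 = height x ^ 2 - 1 := by rw [height_sq]; ring
  have ep : ‖p‖ ^ 2 = height p ^ 2 - 1 := by rw [height_sq]; ring
  have ei : inner ℝ p x = height p * height x - c := by rw [hc]; ring
  -- Cauchy-Schwarz for the metric at `x`, applied to `v` and the tangential projection `p - c • x`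
  -- of `p`, whose squared length is `c ^ 2 - 1`, that is `sinh ^ 2` of the distance.
  have h1 := LinearMap.BilinForm.apply_sq_le_of_symm B
    (fun v => (hBq v).symm ▸ hypForm_nonneg x v)
    ⟨fun v w => by simp only [hBv, RingHom.id_apply]; rw [real_inner_comm, mul_comm (inner ℝ x v)]⟩
    (p - c • x) v
  have e1 : B (p - c • x) v = -(height p * ((height x)⁻¹ * inner ℝ x v) - inner ℝ p v) := by
    rw [hBv, e0]
    simp only [inner_sub_left, inner_sub_right, real_inner_smul_left, real_inner_smul_right,
      real_inner_self_eq_norm_sq]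
    rw [real_inner_comm p x, ei, en]
    field_simp
    ring
  have e2 : B (p - c • x) (p - c • x) = c ^ 2 - 1 := by
    rw [hBv, e0]
    simp only [inner_sub_left, inner_sub_right, real_inner_smul_left, real_inner_smul_right,
      real_inner_self_eq_norm_sq, norm_smul, mul_pow, Real.norm_eq_abs, sq_abs]
    rw [real_inner_comm p x, ei, en, ep]
    field_simp
    ring
  rwa [e1, e2, neg_sq, hBq] at h1

/-- The curve joining two points of the hyperboloid which is obtained by central projection of
their chord. -/
def hypSeg (u v : E) (s : ℝ) : E :=
  (√(1 + s * (1 - s) * hypChord u v))⁻¹ • ((1 - s) • u + s • v)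

lemma one_le_hypSeg_aux (u v : E) {s : ℝ} (hs : s ∈ Icc (0 : ℝ) 1) :
    1 ≤ 1 + s * (1 - s) * hypChord u v :=
  le_add_of_nonneg_right (mul_nonneg (mul_nonneg hs.1 (sub_nonneg.2 hs.2)) (hypChord_nonneg u v))

/-- The chord has Minkowski velocity squared `D` and position squared `-r ^ 2`. Dividing it by `r`
gives squared speed `(D + r' ^ 2) / r ^ 2`, where `r ≥ 1` and `|r'| ≤ D / 2`. -/
lemma hypForm_hypSeg_le (u v : E) {s : ℝ} (hs : s ∈ Icc (0 : ℝ) 1) :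
    ∃ w, HasDerivAt (hypSeg u v) w s ∧
      hypForm (hypSeg u v s) w ≤ hypChord u v + hypChord u v ^ 2 / 4 := by
  set D := hypChord u v with hD
  have hD0 : 0 ≤ D := hypChord_nonneg u v
  have hpos : 0 < 1 + s * (1 - s) * D := one_pos.trans_le (one_le_hypSeg_aux u v hs)
  set r := √(1 + s * (1 - s) * D) with hr
  have hr2 : r ^ 2 = 1 + s * (1 - s) * D := Real.sq_sqrt hpos.le
  have hr0 : 0 < r := Real.sqrt_pos.2 hpos
  set y := (1 - s) • u + s • v with hy
  set r' := (1 - 2 * s) * D / (2 * r) with hr'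
  have hrr : 2 * r * r' = (1 - 2 * s) * D := by rw [hr']; field_simp
  have d1 : HasDerivAt (fun s : ℝ => 1 + s * (1 - s) * D) ((1 - 2 * s) * D) s :=
    ((((hasDerivAt_id' s).mul ((hasDerivAt_id' s).const_sub 1)).mul_const D).const_add 1).congr_deriv
      (by ring)
  have d2 : HasDerivAt (fun s : ℝ => √(1 + s * (1 - s) * D)) r' s := d1.sqrt hpos.ne'
  have d3 : HasDerivAt (fun s : ℝ => (1 - s) • u + s • v) (v - u) s := by
    refine ((((hasDerivAt_id' s).const_sub 1).smul_const u).add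
      ((hasDerivAt_id' s).smul_const v)).congr_deriv ?_
    rw [neg_one_smul, one_smul]; abel
  have d4 := (d2.inv hr0.ne').smul d3
  refine ⟨_, d4, ?_⟩
  set b := (1 - s) * height u + s * height v with hb
  have hb0 : 0 < b := by
    have h1 := height_pos u
    have h2 := height_pos v
    rcases hs.1.eq_or_lt with h | h
    · rw [hb, ← h]; simpa using h1
    · have := mul_nonneg (sub_nonneg.2 hs.2) h1.le
      have := mul_pos h h2
      linarith
  set b' := height v - height u with hb'
  have hF : D = 2 * (height u * height v - inner ℝ u v - 1) := rfl
  have hu := height_sq u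
  have hv := height_sq v
  have i1 : ‖y‖ ^ 2 = b ^ 2 - r ^ 2 := by
    rw [hy, norm_add_sq_real, real_inner_smul_left, real_inner_smul_right, norm_smul, norm_smul,
      mul_pow, mul_pow, Real.norm_eq_abs, Real.norm_eq_abs, sq_abs, sq_abs, hr2, hb]
    linear_combination (-(1 - s) ^ 2) * hu - s ^ 2 * hv + s * (1 - s) * hF
  have i2 : inner ℝ y (v - u) = b * b' - r * r' := by
    rw [hy, inner_add_left, real_inner_smul_left, real_inner_smul_left, inner_sub_right,
      inner_sub_right, real_inner_self_eq_norm_sq, real_inner_self_eq_norm_sq,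
      real_inner_comm u v, hb, hb']
    linear_combination (1 - s) * hu - s * hv + (1 / 2) * hrr + (1 / 2 - s) * hF
  have i3 : ‖v - u‖ ^ 2 = D + b' ^ 2 := by rw [hD, hypChord_eq]; ring
  have hseg : hypSeg u v s = r⁻¹ • y := rfl
  have i4 : (1 + ‖hypSeg u v s‖ ^ 2)⁻¹ = r ^ 2 / b ^ 2 := by
    rw [hseg, norm_smul, mul_pow, norm_inv, Real.norm_of_nonneg hr0.le, i1]
    field_simp
    ring
  have key : hypForm (hypSeg u v s) (r⁻¹ • (v - u) + (-r' / r ^ 2) • y) = (D + r' ^ 2) / r ^ 2 := by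
    rw [hypForm, i4, hseg, norm_add_sq_real]
    simp only [inner_add_right, real_inner_smul_left, real_inner_smul_right, norm_smul, mul_pow,
      Real.norm_eq_abs, sq_abs, real_inner_self_eq_norm_sq]
    rw [real_inner_comm y (v - u), i1, i2, i3]
    field_simp
    ring
  have hr1 : 1 ≤ r ^ 2 := by rw [hr2]; exact one_le_hypSeg_aux u v hs
  have hr'2 : r' ^ 2 ≤ D ^ 2 / 4 := by
    have e : 4 * (r ^ 2 * r' ^ 2) = (1 - 2 * s) ^ 2 * D ^ 2 := by
      linear_combination (2 * r * r' + (1 - 2 * s) * D) * hrr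
    have h1 : (1 - 2 * s) ^ 2 ≤ 1 := by nlinarith [hs.1, hs.2]
    have h2 := mul_le_mul_of_nonneg_right h1 (sq_nonneg D)
    have h3 := mul_le_mul_of_nonneg_right hr1 (sq_nonneg r')
    linarith
  refine key.trans_le ((div_le_self (by positivity) hr1).trans ?_)
  linarith

lemma continuousOn_hypSeg :
    ContinuousOn (fun z : (E × E) × ℝ => hypSeg z.1.1 z.1.2 z.2) {z | z.2 ∈ Icc (0 : ℝ) 1} := by
  have hc : Continuous fun z : (E × E) × ℝ => hypChord z.1.1 z.1.2 := by
    unfold hypChord; fun_prop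
  refine ContinuousOn.smul (ContinuousOn.inv₀ (Continuous.continuousOn (by fun_prop)) ?_)
    (Continuous.continuousOn (by fun_prop))
  intro z hz
  exact (Real.sqrt_pos.2 (one_pos.trans_le (one_le_hypSeg_aux _ _ hz))).ne'

lemma contDiffOn_hypSeg (u v : E) : ContDiffOn ℝ ∞ (hypSeg u v) (Icc 0 1) := by
  have h : ∀ s ∈ Icc (0 : ℝ) 1, 0 < 1 + s * (1 - s) * hypChord u v := fun s hs =>
    one_pos.trans_le (one_le_hypSeg_aux u v hs)
  refine ContDiffOn.smul (ContDiffOn.inv (ContDiffOn.sqrt ?_ fun s hs => (h s hs).ne') ?_) ?_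
  · exact ContDiff.contDiffOn (by fun_prop)
  · exact fun s hs => (Real.sqrt_pos.2 (h s hs)).ne'
  · exact ContDiff.contDiffOn (by fun_prop)

/-- From `cosh z ≤ exp (z ^ 2 / 2)` and the quadratic remainder of `exp`; this compares the squared
chord with the squared distance. -/
lemma two_mul_cosh_sub_one_le {c z : ℝ} (hz0 : 0 ≤ z) (hz : z < min 1 (c - 1)) :
    2 * (Real.cosh z - 1) ≤ c * z ^ 2 := by
  have hz1 : z < 1 := hz.trans_le (min_le_left _ _)
  have hzc : z < c - 1 := hz.trans_le (min_le_right _ _)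
  have h1 := Real.cosh_le_exp_half_sq z
  have hw : z ^ 2 / 2 ≤ z := by nlinarith
  have h2 := (abs_le.1 (Real.abs_exp_sub_one_sub_id_le (x := z ^ 2 / 2)
    (by rw [abs_of_nonneg (by positivity)]; linarith))).2
  have h3 : (z ^ 2 / 2) ^ 2 ≤ (c - 1) * (z ^ 2 / 2) := by
    rw [sq]; exact mul_le_mul_of_nonneg_right (hw.trans hzc.le) (by positivity)
  linarith

/-- A curve of hyperbolic speed less than `κ` with respect to `t` stays in the ball of radius
`κ (t β - t α)`. -/
lemma cosh_dist_le_of_speed {κ α β : ℝ} {x : ℝ → E} {t : ℝ → ℝ} (hκ : 0 < κ) (hαβ : α ≤ β)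
    (hx : ContinuousOn x (Icc α β)) (ht : ContinuousOn t (Icc α β))
    (hd : ∀ u ∈ Ico α β, ∃ (X' : E) (t' : ℝ), HasDerivWithinAt x X' (Ici u) u ∧
      HasDerivWithinAt t t' (Ici u) u ∧ 0 < t' ∧ hypForm (x u) X' < κ ^ 2 * t' ^ 2) :
    height (x α) * height (x β) - inner ℝ (x α) (x β) ≤ Real.cosh (κ * (t β - t α)) := by
  choose! X' t' h1 h2 h3 h4 using hd
  have hmono := le_of_hasDerivWithinAt_pos ht h2 h3
  set p := x α with hp
  have hheight : ∀ u ∈ Ico α β, HasDerivWithinAt (fun u => height (x u))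
      ((height (x u))⁻¹ * inner ℝ (x u) (X' u)) (Ici u) u := by
    intro u hu
    have := ((h1 u hu).norm_sq.const_add 1).sqrt (by positivity)
    refine this.congr_deriv ?_
    change 2 * inner ℝ (x u) (X' u) / (2 * height (x u)) = _
    field_simp
  -- The comparison needs a strict inequality of derivatives where the two sides meet. The shift `μ`
  -- keeps the factor `sinh` positive, also at the start where the distance is zero; then `μ → 0`.
  have bound : ∀ μ > 0, height p * height (x β) - inner ℝ p (x β) ≤
      Real.cosh (κ * (t β - t α) + μ) := by
    intro μ hμ
    refine image_le_of_deriv_right_lt_deriv_boundary'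
      (f := fun u => height p * height (x u) - inner ℝ p (x u))
      (f' := fun u => height p * ((height (x u))⁻¹ * inner ℝ (x u) (X' u)) - inner ℝ p (X' u))
      (B := fun u => Real.cosh (κ * (t u - t α) + μ))
      (B' := fun u => Real.sinh (κ * (t u - t α) + μ) * (κ * t' u))
      ?_ (fun u hu => ?_) ?_ ?_ (fun u hu => ?_) (fun u hu he => ?_) (right_mem_Icc.2 hαβ)
    · exact (continuousOn_const.mul (continuous_height.comp_continuousOn hx)).sub
        (continuousOn_const.inner hx)
    · exact ((hheight u hu).const_mul _).sub
        (((hasDerivWithinAt_const u (Ici u) p).inner ℝ (h1 u hu)).congr_deriv (by simp))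
    · rw [← hp, real_inner_self_eq_norm_sq, ← sq, height_sq, add_sub_cancel_right]
      exact Real.one_le_cosh _
    · exact Real.continuous_cosh.comp_continuousOn
        ((continuousOn_const.mul (ht.sub continuousOn_const)).add continuousOn_const)
    · exact (Real.hasDerivAt_cosh _).comp_hasDerivWithinAt u
        ((((h2 u hu).sub_const _).const_mul κ).add_const μ)
    · have hz : 0 < κ * (t u - t α) + μ :=
        add_pos_of_nonneg_of_pos (mul_nonneg hκ.le
          (sub_nonneg.2 (hmono u (Ico_subset_Icc_self hu)))) hμ
      have hsinh := Real.sinh_pos_iff.2 hz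
      have hcs := sq_deriv_cosh_dist_le p (x u) (X' u)
      have he' : height p * height (x u) - inner ℝ p (x u) =
          Real.cosh (κ * (t u - t α) + μ) := he
      rw [he', ← Real.sinh_sq] at hcs
      have ht' := h3 u hu
      refine lt_of_pow_lt_pow_left₀ 2 (by positivity) (hcs.trans_lt ?_)
      rw [mul_pow, mul_pow]
      exact mul_lt_mul_of_pos_left (h4 u hu) (by positivity)
  have hlim : Tendsto (fun μ => Real.cosh (κ * (t β - t α) + μ)) (𝓝[>] 0)
      (𝓝 (Real.cosh (κ * (t β - t α)))) :=
    (Continuous.tendsto' (by fun_prop) _ _ (by simp)).mono_left nhdsWithin_le_nhds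
  exact ge_of_tendsto hlim (eventually_mem_nhdsWithin.mono fun μ hμ => bound μ hμ)

end Hyperbolic

lemma hyperbolicMetric_apply_self (d : ℕ) (p v : EuclideanSpace ℝ (Fin d)) :
    hyperbolicMetric d p v v = hypForm p v := by
  change inner ℝ v v - (1 + ‖p‖ ^ 2)⁻¹ * (inner ℝ p v * inner ℝ p v) = hypForm p v
  rw [hypForm, real_inner_self_eq_norm_sq, ← sq]

/-- Hyperbolic space in hyperboloid coordinates, with geodesic segments. -/
def hyperbolicGeometry (d : ℕ) :
    ChordGeometry (hyperbolicMetric d) (EuclideanSpace ℝ (Fin d)) where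
  ι := id
  Q := hypForm
  F := hypChord
  seg := hypSeg
  ε₀ := 1
  contMDiff_ι := contMDiff_id
  metric_eq p v := by
    rw [mfderiv_id]
    exact hyperbolicMetric_apply_self d p v
  continuous_Q := by
    unfold hypForm
    have : ∀ z : EuclideanSpace ℝ (Fin d) × EuclideanSpace ℝ (Fin d), 1 + ‖z.1‖ ^ 2 ≠ 0 :=
      fun z => by positivity
    fun_prop (disch := assumption)
  continuous_F := by unfold hypChord; fun_prop
  F_self := hypChord_self
  F_comm := hypChord_comm
  ε₀_pos := one_pos
  seg_zero u v _ := by simp [hypSeg]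
  seg_one u v _ := by simp [hypSeg]
  seg_self u s _ := by rw [hypSeg, hypChord_self, ← add_smul]; simp
  continuousOn_seg := continuousOn_hypSeg.mono fun z hz => hz.2
  contMDiffOn_seg u v _ := (contDiffOn_hypSeg u v).contMDiffOn
  seg_speed c hc := by
    -- For `D ≤ 4 * (c - 1)` one has `D + D ^ 2 / 4 ≤ c * D`.
    refine ⟨4 * (c - 1), by linarith, fun u v hF _ s hs => ?_⟩
    obtain ⟨w, hw, hle⟩ := hypForm_hypSeg_le u v hs
    have e : derivWithin (fun s => id (hypSeg u v s)) (Icc 0 1) s = w :=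
      hw.hasDerivWithinAt.derivWithin (uniqueDiffOn_Icc one_pos s hs)
    rw [e]
    refine hle.trans ?_
    nlinarith [mul_nonneg (hypChord_nonneg u v) (sub_pos.2 hF).le]
  F_le c hc := by
    refine ⟨min 1 (c - 1), lt_min one_pos (sub_pos.2 hc),
      fun κ x t α β hκ hαβ hx ht hd hsmall => ?_⟩
    have h1 := cosh_dist_le_of_speed hκ hαβ hx ht hd
    have h2 : t α ≤ t β := by
      choose! X' t' h1 h2 h3 h4 using hd
      exact le_of_hasDerivWithinAt_pos ht h2 h3 β (right_mem_Icc.2 hαβ)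
    have h3 := two_mul_cosh_sub_one_le (mul_nonneg hκ.le (sub_nonneg.2 h2)) hsmall
    unfold hypChord
    linarith
  homogeneous p x y h := hypChord_homogeneous h
  isPreconnected_inter p q J c hJ h0 _ :=
    isPreconnected_inter_of_convexOn convexOn_hypChord hypChord_nonneg p q c hJ h0

/-! ### Intersections of two spherical caps -/

section Caps

variable {E : Type*} [NormedAddCommGroup E] [InnerProductSpace ℝ E]

lemma norm_sub_sq_of_unit {x y : E} (hx : ‖x‖ = 1) (hy : ‖y‖ = 1) :
    ‖x - y‖ ^ 2 = 2 - 2 * inner ℝ x y := by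
  rw [norm_sub_sq_real, hx, hy]; ring

/-- The part of a vector orthogonal to a proper subspace is a nonnegative multiple of a unit
vector. -/
lemma exists_unit_orthogonal (K : Submodule ℝ E) [K.HasOrthogonalProjection] (hK : K ≠ ⊤) (v : E) :
    ∃ w ∈ Kᗮ, ‖w‖ = 1 ∧ ∃ k ∈ K, ∃ l : ℝ, 0 ≤ l ∧ v = k + l • w := by
  obtain ⟨k, hk, z, hz, hv⟩ := K.exists_add_mem_mem_orthogonal v
  by_cases h : z = 0
  · have hne : Kᗮ ≠ ⊥ := fun h' => hK (K.orthogonal_eq_bot_iff.1 h')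
    obtain ⟨w, hw, hw0⟩ := Submodule.exists_mem_ne_zero_of_ne_bot hne
    refine ⟨‖w‖⁻¹ • w, Kᗮ.smul_mem _ hw, ?_, k, hk, 0, le_rfl, by simp [hv, h]⟩
    rw [norm_smul, norm_inv, norm_norm, inv_mul_cancel₀ (norm_ne_zero_iff.2 hw0)]
  · refine ⟨‖z‖⁻¹ • z, Kᗮ.smul_mem _ hz, ?_, k, hk, ‖z‖, norm_nonneg _, ?_⟩
    · rw [norm_smul, norm_inv, norm_norm, inv_mul_cancel₀ (norm_ne_zero_iff.2 h)]
    · rw [smul_inv_smul₀ (norm_ne_zero_iff.2 h), hv]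

/-- The region under the upper unit half circle is convex. -/
lemma concaveOn_sqrt_one_sub_sq : ConcaveOn ℝ (Icc (-1 : ℝ) 1) fun s => √(1 - s ^ 2) := by
  refine ⟨convex_Icc _ _, fun x hx y hy α β hα hβ hαβ => ?_⟩
  have hx2 : 0 ≤ 1 - x ^ 2 := by nlinarith [hx.1, hx.2]
  have hy2 : 0 ≤ 1 - y ^ 2 := by nlinarith [hy.1, hy.2]
  have hxy : √(1 - x ^ 2) * √(1 - y ^ 2) ≤ 1 - x * y := by
    rw [← Real.sqrt_mul hx2]
    refine Real.sqrt_le_iff.2 ⟨by nlinarith [hx.1, hx.2, hy.1, hy.2], ?_⟩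
    nlinarith [sq_nonneg (x - y)]
  refine Real.le_sqrt_of_sq_le ?_
  simp only [smul_eq_mul]
  have h1 := mul_le_mul_of_nonneg_left hxy (mul_nonneg hα hβ)
  have h2 : (α + β) ^ 2 = 1 := by rw [hαβ, one_pow]
  have h3 : (α * √(1 - x ^ 2) + β * √(1 - y ^ 2)) ^ 2 = α ^ 2 * (1 - x ^ 2) +
      2 * (α * β * (√(1 - x ^ 2) * √(1 - y ^ 2))) + β ^ 2 * (1 - y ^ 2) := by
    linear_combination α ^ 2 * Real.sq_sqrt hx2 + β ^ 2 * Real.sq_sqrt hy2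
  rw [h3]
  nlinarith

/-- In a sphere of dimension at least two, the intersection of two caps is preconnected. -/
lemma isPreconnected_inter_caps [FiniteDimensional ℝ E] (hE : 3 ≤ Module.finrank ℝ E) {p q : E}
    (hp : ‖p‖ = 1) (hq : ‖q‖ = 1) {J : Set ℝ} {c : ℝ} (hJ : J.OrdConnected) (h0 : 0 ∈ J) :
    IsPreconnected {x : E | ‖x‖ = 1 ∧ ‖x - p‖ ^ 2 ∈ J ∧ ‖x - q‖ ^ 2 < c} := by
  set A := {x : E | ‖x‖ = 1 ∧ ‖x - p‖ ^ 2 ∈ J ∧ ‖x - q‖ ^ 2 < c} with hA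
  -- On the unit sphere the chords to `p` and `q` are decreasing functions of the inner products, so
  -- it suffices not to decrease these below the values at points of `A`.
  have mem : ∀ {x x' y : E}, x ∈ A → x' ∈ A → ‖y‖ = 1 →
      min (inner ℝ x p) (inner ℝ x' p) ≤ inner ℝ y p →
      min (inner ℝ x q) (inner ℝ x' q) ≤ inner ℝ y q → y ∈ A := by
    rintro x x' y ⟨h1, h2, h3⟩ ⟨h1', h2', h3'⟩ hy k1 k2
    rw [norm_sub_sq_of_unit ‹_› ‹_›] at h2 h3 h2' h3'
    have hpos : 0 ≤ ‖y - p‖ ^ 2 := by positivity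
    refine ⟨hy, ?_, ?_⟩
    · rw [norm_sub_sq_of_unit hy hp] at hpos ⊢
      rcases min_le_iff.1 k1 with h | h
      · exact hJ.out h0 h2 ⟨hpos, by linarith⟩
      · exact hJ.out h0 h2' ⟨hpos, by linarith⟩
    · rw [norm_sub_sq_of_unit hy hq]
      rcases min_le_iff.1 k2 with h | h <;> linarith
  have hspan : ∀ s : Finset E, s.card ≤ 2 → Submodule.span ℝ (s : Set E) ≠ ⊤ := by
    intro s hs htop
    have := finrank_span_finset_le_card (R := ℝ) s
    rw [Set.finrank, htop, finrank_top] at this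
    omega
  classical
  -- `p = k • q + l • e` with `l ≥ 0`: with the `q`-component fixed, moving towards `e` does not
  -- decrease the inner product with `p`. If `p = ± q`, any unit `e` orthogonal to `q` serves.
  obtain ⟨e, heK, he, k, hk, l, hl, hpe⟩ := exists_unit_orthogonal (Submodule.span ℝ {q})
    (by simpa using hspan {q} (by simp)) p
  obtain ⟨k, rfl⟩ := Submodule.mem_span_singleton.1 hk
  have hqe : inner ℝ q e = 0 :=
    (Submodule.mem_orthogonal _ _).1 heK q (Submodule.mem_span_singleton_self q)
  have heq : inner ℝ e q = 0 := by rw [real_inner_comm]; exact hqe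
  have hqq : inner ℝ q q = 1 := by rw [real_inner_self_eq_norm_sq, hq, one_pow]
  have hee : inner ℝ e e = 1 := by rw [real_inner_self_eq_norm_sq, he, one_pow]
  have hle1 : ∀ x ∈ A, inner ℝ x q ∈ Icc (-1 : ℝ) 1 := fun x hx => by
    have := abs_real_inner_le_norm x q
    rw [hx.1, hq, one_mul] at this
    exact abs_le.1 this
  set z : ℝ → E := fun s => s • q + √(1 - s ^ 2) • e with hz
  have hzp : ∀ s, inner ℝ (z s) p = k * s + l * √(1 - s ^ 2) := fun s => by
    simp only [hz, hpe, inner_add_left, inner_add_right, real_inner_smul_left,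
      real_inner_smul_right, hqq, hee, hqe, heq]; ring
  have hzq : ∀ s, inner ℝ (z s) q = s := fun s => by
    simp only [hz, inner_add_left, real_inner_smul_left, hqq, heq]; ring
  have hz1 : ∀ s ∈ Icc (-1 : ℝ) 1, ‖z s‖ = 1 := fun s hs => by
    have h2 : 0 ≤ 1 - s ^ 2 := by nlinarith [hs.1, hs.2]
    have : ‖z s‖ ^ 2 = 1 := by
      rw [← real_inner_self_eq_norm_sq]
      simp only [hz, inner_add_left, inner_add_right, real_inner_smul_left,
        real_inner_smul_right, hqq, hee, hqe, heq]
      linear_combination Real.sq_sqrt h2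
    exact (pow_eq_one_iff_of_nonneg (norm_nonneg _) two_ne_zero).1 this
  -- every point of `A` is joined inside `A` to the point of the meridian `z` at the same height
  have path : ∀ x ∈ A, ∃ t ⊆ A, x ∈ t ∧ z (inner ℝ x q) ∈ t ∧ IsPreconnected t := by
    intro x hx
    set s := inner ℝ x q with hs
    -- Here dimension at least three is used: there is a unit vector `w` orthogonal to `q` and `e`,
    -- even when `x` lies in their span.
    have hK := hspan {q, e} Finset.card_le_two
    rw [Finset.coe_pair] at hK
    obtain ⟨w, hwK, hw, u, hu, b, hb, hxw⟩ := exists_unit_orthogonal _ hK x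
    obtain ⟨s', m, rfl⟩ := Submodule.mem_span_pair.1 hu
    have hqw : inner ℝ q w = 0 := (Submodule.mem_orthogonal _ _).1 hwK q
      (Submodule.subset_span (by simp))
    have hew : inner ℝ e w = 0 := (Submodule.mem_orthogonal _ _).1 hwK e
      (Submodule.subset_span (by simp))
    have hwq : inner ℝ w q = 0 := by rw [real_inner_comm]; exact hqw
    have hwe : inner ℝ w e = 0 := by rw [real_inner_comm]; exact hew
    have hww : inner ℝ w w = 1 := by rw [real_inner_self_eq_norm_sq, hw, one_pow]
    have hss' : s = s' := by
      rw [hs, hxw]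
      simp only [inner_add_left, real_inner_smul_left, hqq, heq, hwq]; ring
    rw [← hss'] at hxw
    have hsum : s ^ 2 + m ^ 2 + b ^ 2 = 1 := by
      have h1 : inner ℝ x x = 1 := by rw [real_inner_self_eq_norm_sq, hx.1, one_pow]
      rw [← h1, hxw]
      simp only [inner_add_left, inner_add_right, real_inner_smul_left, real_inner_smul_right,
        hqq, heq, hwq, hqe, hqw, hee, hew, hwe, hww]; ring
    have hm : m ≤ √(1 - s ^ 2) := Real.le_sqrt_of_sq_le (by nlinarith)
    -- The arc at constant `q`-height `s` from `x`, at `y = m`, to the meridian, at `y = √(1 - s ^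
    -- 2)`.
    set f : ℝ → E := fun y => s • q + y • e + √(1 - s ^ 2 - y ^ 2) • w with hf
    have hfm : f m = x := by
      have : 1 - s ^ 2 - m ^ 2 = b ^ 2 := by linarith
      simp only [hf]
      rw [this, Real.sqrt_sq hb, hxw]
    have hs2 : 0 ≤ 1 - s ^ 2 := by nlinarith
    refine ⟨f '' Icc m √(1 - s ^ 2), ?_, ⟨m, left_mem_Icc.2 hm, hfm⟩,
      ⟨_, right_mem_Icc.2 hm, ?_⟩, isPreconnected_Icc.image _ (Continuous.continuousOn ?_)⟩
    · rintro _ ⟨y, hy, rfl⟩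
      have hy2 : 0 ≤ 1 - s ^ 2 - y ^ 2 := by
        have h1 : y ^ 2 ≤ max (m ^ 2) (√(1 - s ^ 2) ^ 2) := by
          rcases le_total 0 y with h | h
          · exact le_max_of_le_right (by gcongr; exact hy.2)
          · refine le_max_of_le_left ?_
            nlinarith [hy.1]
        rw [Real.sq_sqrt hs2] at h1
        have : m ^ 2 ≤ 1 - s ^ 2 := by nlinarith
        rw [max_eq_right this] at h1
        linarith
      have hfp : ∀ y, inner ℝ (f y) p = k * s + l * y := fun y => by
        simp only [hf, hpe, inner_add_left, inner_add_right, real_inner_smul_left,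
          real_inner_smul_right, hqq, hee, hqe, heq, hwq, hwe]; ring
      refine mem hx hx ?_ ?_ ?_
      · have : ‖f y‖ ^ 2 = 1 := by
          rw [← real_inner_self_eq_norm_sq]
          simp only [hf, inner_add_left, inner_add_right, real_inner_smul_left,
            real_inner_smul_right, hqq, heq, hwq, hqe, hqw, hee, hew, hwe, hww]
          linear_combination Real.sq_sqrt hy2
        exact (pow_eq_one_iff_of_nonneg (norm_nonneg _) two_ne_zero).1 this
      · rw [min_self, hfp, ← hfm, hfp]
        have := mul_le_mul_of_nonneg_left hy.1 hl
        linarith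
      · rw [min_self, ← hs]
        refine le_of_eq ?_
        simp only [hf, inner_add_left, real_inner_smul_left, hqq, heq, hwq]; ring
    · simp only [hf, hz, Real.sq_sqrt hs2, sub_self, Real.sqrt_zero, zero_smul, add_zero]
    · fun_prop
  rcases A.eq_empty_or_nonempty with hempty | ⟨x₁, hx₁⟩
  · rw [hempty]; exact isPreconnected_empty
  set s₁ := inner ℝ x₁ q with hs₁
  have hzA : ∀ x ∈ A, z (inner ℝ x q) ∈ A := fun x hx => by
    obtain ⟨t, ht, -, h, -⟩ := path x hx
    exact ht h
  have hconc : ConcaveOn ℝ (Icc (-1 : ℝ) 1) fun s => k * s + l * √(1 - s ^ 2) :=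
    (LinearMap.concaveOn (LinearMap.mul ℝ ℝ k) (convex_Icc _ _)).add
      (concaveOn_sqrt_one_sub_sq.smul hl)
  -- Any `x` slides to the meridian and then along it to `z s₁`. The inner product with `p` is
  -- concave in the height, so it stays above the smaller of its end values.
  refine isPreconnected_of_forall (z s₁) fun x hx => ?_
  obtain ⟨t, htA, hxt, hzt, ht⟩ := path x hx
  refine ⟨t ∪ z '' uIcc (inner ℝ x q) s₁, union_subset htA ?_, Or.inr ⟨s₁, by simp, rfl⟩,
    Or.inl hxt, ht.union _ hzt ⟨_, by simp, rfl⟩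
      (isPreconnected_uIcc.image _ (Continuous.continuousOn (by fun_prop)))⟩
  rintro _ ⟨s, hs, rfl⟩
  have hsI : s ∈ Icc (-1 : ℝ) 1 :=
    ordConnected_Icc.uIcc_subset (hle1 x hx) (hle1 x₁ hx₁) hs
  refine mem (hzA x hx) (hzA x₁ hx₁) (hz1 s hsI) ?_ ?_
  · rw [hzp, hzp, hzp]
    exact hconc.min_le_of_mem_segment (hle1 x hx) (hle1 x₁ hx₁) (segment_eq_uIcc _ s₁ ▸ hs)
  · rw [hzq, hzq, hzq]
    exact hs.1

end Caps

/-! ### The round sphere and the three cases -/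

section Sphere

variable {E : Type*} [NormedAddCommGroup E] [InnerProductSpace ℝ E]

open Classical in
/-- The central projection of the chord from `u` to `v` to the unit sphere. -/
def sphereSeg (u v : Metric.sphere (0 : E) 1) (s : ℝ) : Metric.sphere (0 : E) 1 :=
  if h : (1 - s) • (u : E) + s • (v : E) = 0 then u
  else ⟨‖(1 - s) • (u : E) + s • (v : E)‖⁻¹ • ((1 - s) • (u : E) + s • (v : E)), by
    rw [mem_sphere_zero_iff_norm, norm_smul, norm_inv, norm_norm,
      inv_mul_cancel₀ (norm_ne_zero_iff.2 h)]⟩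

lemma norm_chord_sq (u v : Metric.sphere (0 : E) 1) (s : ℝ) :
    ‖(1 - s) • (u : E) + s • (v : E)‖ ^ 2 = 1 - s * (1 - s) * ‖(v : E) - u‖ ^ 2 := by
  have hu : ‖(u : E)‖ = 1 := norm_eq_of_mem_sphere u
  have hv : ‖(v : E)‖ = 1 := norm_eq_of_mem_sphere v
  rw [norm_sub_sq_of_unit hv hu, norm_add_sq_real, real_inner_smul_left, real_inner_smul_right,
    norm_smul, norm_smul, mul_pow, mul_pow, hu, hv, Real.norm_eq_abs, Real.norm_eq_abs, sq_abs,
    sq_abs, real_inner_comm]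
  ring

/-- The chord is closest to the origin at its midpoint. -/
lemma norm_chord_sq_ge {u v : Metric.sphere (0 : E) 1} (s : ℝ) :
    1 - ‖(v : E) - u‖ ^ 2 / 4 ≤ ‖(1 - s) • (u : E) + s • (v : E)‖ ^ 2 := by
  rw [norm_chord_sq]
  nlinarith [mul_nonneg (sq_nonneg (2 * s - 1)) (sq_nonneg ‖(v : E) - u‖)]

lemma chord_ne_zero {u v : Metric.sphere (0 : E) 1} (h : ‖(v : E) - u‖ ^ 2 < 1) (s : ℝ) :
    (1 - s) • (u : E) + s • (v : E) ≠ 0 := by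
  intro h0
  have := norm_chord_sq_ge (u := u) (v := v) s
  rw [h0, norm_zero] at this
  linarith

lemma coe_sphereSeg {u v : Metric.sphere (0 : E) 1} (h : ‖(v : E) - u‖ ^ 2 < 1) (s : ℝ) :
    (sphereSeg u v s : E) =
      ‖(1 - s) • (u : E) + s • (v : E)‖⁻¹ • ((1 - s) • (u : E) + s • (v : E)) := by
  rw [sphereSeg, dif_neg (chord_ne_zero h s)]

lemma continuousOn_sphereSeg : ContinuousOn
    (fun z : (Metric.sphere (0 : E) 1 × Metric.sphere (0 : E) 1) × ℝ => sphereSeg z.1.1 z.1.2 z.2)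
    {z | ‖(z.1.2 : E) - z.1.1‖ ^ 2 < 1} := by
  rw [IsInducing.subtypeVal.continuousOn_iff]
  have : ContinuousOn (fun z : (Metric.sphere (0 : E) 1 × Metric.sphere (0 : E) 1) × ℝ =>
      ‖(1 - z.2) • (z.1.1 : E) + z.2 • (z.1.2 : E)‖⁻¹ •
        ((1 - z.2) • (z.1.1 : E) + z.2 • (z.1.2 : E))) {z | ‖(z.1.2 : E) - z.1.1‖ ^ 2 < 1} :=
    ContinuousOn.smul (ContinuousOn.inv₀ (Continuous.continuousOn (by fun_prop))
      fun z hz => norm_ne_zero_iff.2 (chord_ne_zero hz z.2))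
      (Continuous.continuousOn (by fun_prop))
  exact this.congr fun z hz => coe_sphereSeg hz z.2

lemma contMDiff_sphereSeg {d : ℕ} [Fact (Module.finrank ℝ E = d + 1)]
    {u v : Metric.sphere (0 : E) 1} (h : ‖(v : E) - u‖ ^ 2 < 1) :
    ContMDiff 𝓘(ℝ, ℝ) (𝓡 d) ∞ (sphereSeg u v) := by
  have hy : ContDiff ℝ ∞ fun s : ℝ => (1 - s) • (u : E) + s • (v : E) := by fun_prop
  have h1 : ContDiff ℝ ∞ fun s : ℝ => (sphereSeg u v s : E) := by
    simp only [coe_sphereSeg h]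
    exact ((hy.norm ℝ (chord_ne_zero h)).inv fun s => norm_ne_zero_iff.2 (chord_ne_zero h s)).smul hy
  exact h1.contMDiff.codRestrict_sphere fun s => (sphereSeg u v s).2

/-- Normalising the chord removes the radial part of its velocity, leaving squared speed `(D - r' ^
2) / r ^ 2`, and `r ^ 2 ≥ 1 - D / 4`. -/
lemma sphereSeg_speed {u v : Metric.sphere (0 : E) 1} (h : ‖(v : E) - u‖ ^ 2 < 1) (s : ℝ) :
    ∃ w : E, HasDerivAt (fun s => (sphereSeg u v s : E)) w s ∧
      ‖w‖ ^ 2 * (1 - ‖(v : E) - u‖ ^ 2 / 4) ≤ ‖(v : E) - u‖ ^ 2 := by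
  set D := ‖(v : E) - u‖ ^ 2 with hD
  have hu : ‖(u : E)‖ = 1 := norm_eq_of_mem_sphere u
  have hv : ‖(v : E)‖ = 1 := norm_eq_of_mem_sphere v
  have hr (s : ℝ) : ‖(1 - s) • (u : E) + s • (v : E)‖ = √(1 - s * (1 - s) * D) := by
    rw [← norm_chord_sq, Real.sqrt_sq (norm_nonneg _)]
  have hfun : (fun s => (sphereSeg u v s : E)) =
      fun s => (√(1 - s * (1 - s) * D))⁻¹ • ((1 - s) • (u : E) + s • (v : E)) := by
    funext s; rw [coe_sphereSeg h, hr]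
  set y := (1 - s) • (u : E) + s • (v : E) with hy
  have hge : 1 - D / 4 ≤ ‖y‖ ^ 2 := norm_chord_sq_ge s
  have hpos : 0 < 1 - s * (1 - s) * D := by rw [← norm_chord_sq]; linarith
  set r := √(1 - s * (1 - s) * D) with hrdef
  have hr0 : 0 < r := Real.sqrt_pos.2 hpos
  have hyr : ‖y‖ = r := hr s
  set r' := (-(1 - 2 * s) * D) / (2 * r) with hr'
  have hrr : 2 * r * r' = -(1 - 2 * s) * D := by rw [hr']; field_simp
  have d1 : HasDerivAt (fun s : ℝ => 1 - s * (1 - s) * D) (-(1 - 2 * s) * D) s :=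
    ((((hasDerivAt_id' s).mul ((hasDerivAt_id' s).const_sub 1)).mul_const D).const_sub 1).congr_deriv
      (by ring)
  have d2 : HasDerivAt (fun s : ℝ => √(1 - s * (1 - s) * D)) r' s := d1.sqrt hpos.ne'
  have d3 : HasDerivAt (fun s : ℝ => (1 - s) • (u : E) + s • (v : E)) ((v : E) - u) s := by
    refine ((((hasDerivAt_id' s).const_sub 1).smul_const (u : E)).add
      ((hasDerivAt_id' s).smul_const (v : E))).congr_deriv ?_
    rw [neg_one_smul, one_smul]; abel
  have d4 := (d2.inv hr0.ne').smul d3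
  refine ⟨r⁻¹ • ((v : E) - u) + (-r' / r ^ 2) • y, by rw [hfun]; exact d4, ?_⟩
  have i2 : inner ℝ y ((v : E) - u) = r * r' := by
    have e1 : D = 2 - 2 * inner ℝ (v : E) u := norm_sub_sq_of_unit hv hu
    rw [hy, inner_add_left, real_inner_smul_left, real_inner_smul_left, inner_sub_right,
      inner_sub_right, real_inner_self_eq_norm_sq, real_inner_self_eq_norm_sq, hu, hv,
      real_inner_comm (v : E) u]
    linear_combination (-1 / 2) * hrr + (1 / 2 - s) * e1
  have key : ‖r⁻¹ • ((v : E) - u) + (-r' / r ^ 2) • y‖ ^ 2 = (D - r' ^ 2) / r ^ 2 := by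
    rw [norm_add_sq_real]
    simp only [real_inner_smul_left, real_inner_smul_right, norm_smul, mul_pow,
      Real.norm_eq_abs, sq_abs]
    rw [real_inner_comm y, i2, hyr, ← hD]
    field_simp
    ring
  rw [key, div_mul_eq_mul_div, div_le_iff₀ (by positivity)]
  rw [hyr] at hge
  have hD0 : 0 ≤ D := by positivity
  have h1 : (D - r' ^ 2) * (1 - D / 4) ≤ D * (1 - D / 4) :=
    mul_le_mul_of_nonneg_right (by linarith [sq_nonneg r']) (by linarith)
  exact h1.trans (mul_le_mul_of_nonneg_left hge hD0)

/-- The reflection in the hyperplane orthogonal to `x - y`, which contains `p` because `p` is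
equidistant from `x` and `y`. -/
lemma exists_sphere_isometry {p x y : Metric.sphere (0 : E) 1}
    (h : ‖(x : E) - p‖ ^ 2 = ‖(y : E) - p‖ ^ 2) :
    ∃ σ : Metric.sphere (0 : E) 1 → Metric.sphere (0 : E) 1, σ p = p ∧ σ x = y ∧
      ∀ z w, ‖(σ w : E) - σ z‖ = ‖(w : E) - z‖ := by
  have hn : ∀ z : Metric.sphere (0 : E) 1, ‖(z : E)‖ = 1 := norm_eq_of_mem_sphere
  set R := (ℝ ∙ ((x : E) - y))ᗮ.reflection with hR
  refine ⟨fun z => ⟨R z, by rw [mem_sphere_zero_iff_norm, R.norm_map, hn]⟩, ?_, ?_, fun z w => ?_⟩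
  · refine Subtype.ext (Submodule.reflection_mem_subspace_eq_self ?_)
    rw [norm_sub_sq_of_unit (hn x) (hn p), norm_sub_sq_of_unit (hn y) (hn p)] at h
    rw [Submodule.mem_orthogonal_singleton_iff_inner_right, inner_sub_left]
    linarith
  · exact Subtype.ext (Submodule.reflection_sub (by rw [hn, hn]))
  · simp only [← map_sub, LinearIsometryEquiv.norm_map]

end Sphere

/-- The round sphere of dimension at least two, with great circle segments. -/
def sphereGeometry {d : ℕ} (hd : 2 ≤ d) :
    ChordGeometry (sphereMetric d) (EuclideanSpace ℝ (Fin (d + 1))) where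
  ι x := x
  Q _ v := ‖v‖ ^ 2
  F x y := ‖(y : EuclideanSpace ℝ (Fin (d + 1))) - x‖ ^ 2
  seg := sphereSeg
  ε₀ := 1
  contMDiff_ι :=
    have : Fact (Module.finrank ℝ (EuclideanSpace ℝ (Fin (d + 1))) = d + 1) := ⟨by simp⟩
    contMDiff_coe_sphere
  metric_eq _ _ := real_inner_self_eq_norm_sq (F := EuclideanSpace ℝ (Fin (d + 1))) _
  continuous_Q := by fun_prop
  continuous_F := by fun_prop
  F_self x := by simp
  F_comm x y := by rw [norm_sub_rev]
  ε₀_pos := one_pos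
  seg_zero u v h := Subtype.ext (by rw [coe_sphereSeg h]; simp)
  seg_one u v h := Subtype.ext (by rw [coe_sphereSeg h]; simp)
  seg_self u s _ := Subtype.ext (by
    rw [coe_sphereSeg (by simp), ← add_smul, sub_add_cancel, one_smul, norm_eq_of_mem_sphere,
      inv_one, one_smul])
  continuousOn_seg := continuousOn_sphereSeg.mono fun _ hz => hz.1
  contMDiffOn_seg u v h :=
    have : Fact (Module.finrank ℝ (EuclideanSpace ℝ (Fin (d + 1))) = d + 1) := ⟨by simp⟩
    (contMDiff_sphereSeg h).contMDiffOn
  seg_speed c hc := by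
    have hc0 : 0 < c := one_pos.trans hc
    -- For `D < 4 * (1 - c⁻¹)` the factor `1 - D / 4` exceeds `c⁻¹`.
    refine ⟨4 * (1 - c⁻¹), by have := inv_lt_one_of_one_lt₀ hc; linarith, fun u v hF h1 s hs => ?_⟩
    obtain ⟨w, hw, hle⟩ := sphereSeg_speed h1 s
    rw [hw.hasDerivWithinAt.derivWithin (uniqueDiffOn_Icc one_pos s hs)]
    have h2 : c⁻¹ ≤ 1 - ‖(v : EuclideanSpace ℝ (Fin (d + 1))) - u‖ ^ 2 / 4 := by linarith
    have h3 := (mul_le_mul_of_nonneg_left h2 (sq_nonneg ‖w‖)).trans hle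
    rwa [← div_eq_mul_inv, div_le_iff₀' hc0] at h3
  F_le c hc := by
    refine ⟨1, one_pos, fun κ x t α β hκ hαβ hx ht hd _ => ?_⟩
    have h1 := norm_sub_le_of_speed hκ hαβ (continuous_subtype_val.comp_continuousOn hx) ht hd
    calc _ ≤ (κ * (t β - t α)) ^ 2 := pow_le_pow_left₀ (norm_nonneg _) h1 2
      _ ≤ _ := le_mul_of_one_le_left (by positivity) hc.le
  homogeneous p x y h := by
    obtain ⟨σ, h1, h2, h3⟩ := exists_sphere_isometry h
    exact ⟨σ, h1, h2, fun z w => by rw [h3]⟩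
  isPreconnected_inter p q J c hJ h0 _ := by
    have h := isPreconnected_inter_caps (E := EuclideanSpace ℝ (Fin (d + 1))) (c := c)
      (by simpa using hd) (norm_eq_of_mem_sphere p) (norm_eq_of_mem_sphere q) hJ h0
    rw [← IsInducing.subtypeVal.isPreconnected_image]
    refine Eq.mpr (congrArg IsPreconnected (Set.ext fun x => ?_)) h
    constructor
    · rintro ⟨y, hy, rfl⟩; exact ⟨norm_eq_of_mem_sphere y, hy⟩
    · rintro ⟨hx, hx'⟩; exact ⟨⟨x, mem_sphere_zero_iff_norm.2 hx⟩, hx', rfl⟩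

end FLRW

end

theorem proposition3p1 (d : ℕ) (hd : 2 ≤ d) (a : ℝ → ℝ) (ha : FLRW.IsScaleFactor a) :
    FLRW.WarpedFutureOneConnected a (FLRW.hyperbolicMetric d) ∧
    FLRW.WarpedFutureOneConnected a (FLRW.euclideanMetric d) ∧
    FLRW.WarpedFutureOneConnected a (FLRW.sphereMetric d) := by
  have : LocallyPathConnectedSpace (Metric.sphere (0 : EuclideanSpace ℝ (Fin (d + 1))) 1) :=
    ChartedSpace.locallyPathConnectedSpace (EuclideanSpace ℝ (Fin d)) _
  exact ⟨(FLRW.hyperbolicGeometry d).warpedFutureOneConnected ha,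
    (FLRW.euclideanGeometry d).warpedFutureOneConnected ha,
    (FLRW.sphereGeometry hd).warpedFutureOneConnected ha⟩
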